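/- **Theorem 5.3.** Let $S$ and $T$ be finite disjoint sets and let $E^*$ be the edge set of the complete bipartite graph with colour classes $S$ and $T$. Let $G_0=(S,T;E_0)$, $E_0\subseteq E^*$, be a simple bipartite graph. For a bipartite graph $G=(S,T;F)$ and $X\subseteq T$ let $\Gamma_G(X)\subseteq S$ be the set of vertices of $S$ having a neighbour in $X$; for $F\subseteq E^*$ let $d_F(v)$ be the number of edges of $F$ incident with the vertex $v$. Let $p_T:2^T\to\mathbb Z$ be positively intersecting supermodular, i.e. $p_T(X)+p_T(Y)\le p_T(X\cup Y)+p_T(X\cap Y)$ whenever $X\cap Y$, $X\setminus Y$, $Y\setminus X$ are all nonempty and $p_T(X),p_T(Y)>0$; and assume $p_T\le |S|$. We say that $G$ *covers* $p_T$ if $|\Gamma_G(X)|\ge p_T(X)$ for all $\emptyset\ne X\subseteq T$. Let $\{S_1,\dots,S_l\}$ be a partition of $S$ into nonempty classes, let $f_1,f_2:\{1,\dots,l\}\to\mathbb N$ satisfy $f_1\le f_2$, and let $g:T\to\mathbb N$, where $0\in\mathbb N$. For $S'\subseteq S$ and $t\in T$ put $\overline{S'}=S\setminus S'$ and $g_{S'}(t)=\min\{|S'\setminus\Gamma_{G_0}(\{t\})|,\,g(t)\}$;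 for $h:T\to\mathbb N$ and $X\subseteq T$ put $\widetilde h(X)=\sum_{t\in X}h(t)$. There exists $E\subseteq E^*$ such that - (i) the graph $G^+=(S,T;E\cup E_0)$ is simple (i.e. $E\cap E_0=\emptyset$) and covers $p_T$, - (ii) $f_1(\alpha)\le\sum_{s\in S_\alpha}d_E(s)\le f_2(\alpha)$ for $1\le\alpha\le l$, - (iii) $d_E(t)\le g(t)$ for $t\in T$, if and only if for all $n\ge 0$, all pairwise disjoint nonempty $T_1,\dots,T_n\subseteq T$ and every $S_0\subseteq S$ that is the union of some (possibly none) of $S_1,\dots,S_l$, $$\sum_{j=1}^n\bigl(|\overline{S_0}\cup\Gamma_{G_0}(T_j)|+\widetilde g(T_j)\bigr)\ \ge\ \sum_{j=1}^n p_T(T_j)+\sum_{S_\alpha\subseteq\overline{S_0}}f_1(\alpha)-\widetilde{g}_{\overline{S_0}}\Bigl(T\setminus\bigcup_{j=1}^nT_j\Bigr)\qquad(40)$$ and $$\sum_{j=1}^n\bigl(p_T(T_j)-|\overline{S_0}\cup\Gamma_{G_0}(T_j)|\bigr)\ \le\ \sum_{S_\alpha\subseteq S_0}f_2(\alpha).\qquad(42)$$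 In particular, for $n=0$, (40) implies $\widetilde g_{\overline{S_0}}(T)\ge\sum_{S_\alpha\subseteq\overline{S_0}}f_1(\alpha)$. Matroidal version: let moreover $M_S$ be a matroid with ground set $S$ and rank function $r_S$. Then there exists $E\subseteq E^*$ satisfying (ii), (iii) and - (i') $G^+=(S,T;E\cup E_0)$ is simple (i.e. $E\cap E_0=\emptyset$) and $r_S(\Gamma_{G^+}(X))\ge p_T(X)$ for all $\emptyset\ne X\subseteq T$, if and only if, for all $n$, $T_1,\dots,T_n$ and $S_0$ as above, (40) and (42) hold with $|\overline{S_0}\cup\Gamma_{G_0}(T_j)|$ replaced by $r_S(\overline{S_0}\cup\Gamma_{G_0}(T_j))$. -/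

import Mathlib

/-!
A simple bipartite graph with colour classes `S` and `T` is given by its edge set, a
`Finset (S × T)`; the set `E*` of all edges of the complete bipartite graph is `Finset.univ`.
Since `E` and `E₀` are both subsets of `E*`, the graph with edge set `E ∪ E₀` (edges of `E` being
added to those of `E₀`) is simple if and only if no edge of `E` is parallel to an edge of `E₀`,
that is, if and only if `E` and `E₀` are disjoint.
-/

namespace BipCover

section

variable {S T : Type*} [Fintype S] [DecidableEq S] [Fintype T] [DecidableEq T]

/-- `Γ_G(X)`: the set of vertices in `S` that have a neighbour in `X ⊆ T`. -/
def nbr (E : Finset (S × T)) (X : Finset T) : Finset S :=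
  Finset.univ.filter fun s => ∃ t ∈ X, (s, t) ∈ E

/-- `d_E(s)`, the number of edges of `E` incident with `s ∈ S`. -/
def degS (E : Finset (S × T)) (s : S) : ℕ := (E.filter fun e => e.1 = s).card

/-- `d_E(t)`, the number of edges of `E` incident with `t ∈ T`. -/
def degT (E : Finset (S × T)) (t : T) : ℕ := (E.filter fun e => e.2 = t).card

/-- `X` and `Y` are properly intersecting. -/
def ProperlyIntersecting (X Y : Finset T) : Prop :=
  (X ∩ Y).Nonempty ∧ (X \ Y).Nonempty ∧ (Y \ X).Nonempty

/-- `p` is positively intersecting supermodular. -/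
def PosIntersectingSupermodular (p : Finset T → ℤ) : Prop :=
  ∀ X Y : Finset T, ProperlyIntersecting X Y → 0 < p X → 0 < p Y →
    p X + p Y ≤ p (X ∪ Y) + p (X ∩ Y)

/-- The graph with edge set `E` covers `p`, sizes of subsets of `S` being measured by `ρ`.
For `ρ = Finset.card` this is ordinary covering; for the rank function `ρ` of a matroid on `S`
it is covering with respect to that matroid. -/
def Covers (ρ : Finset S → ℕ) (E : Finset (S × T)) (p : Finset T → ℤ) : Prop :=
  ∀ X : Finset T, X.Nonempty → p X ≤ (ρ (nbr E X) : ℤ)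

/-- The rank function of a matroid, on finite sets (where the rank is finite). -/
noncomputable def rank (M : Matroid S) (X : Finset S) : ℕ := (M.eRk (X : Set S)).toNat

/-- `P` is (an enumeration of) a partition of `S` into nonempty classes. -/
def IsPartition {l : ℕ} (P : Fin l → Finset S) : Prop :=
  (∀ α, (P α).Nonempty) ∧ (∀ α β, α ≠ β → Disjoint (P α) (P β)) ∧
    Finset.univ.biUnion P = Finset.univ

/-- `S₀` is the union of some (possibly none, possibly all) of the sets `P 0, …, P (l - 1)`. -/
def IsUnionOfParts {l : ℕ} (P : Fin l → Finset S) (S₀ : Finset S) : Prop :=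
  ∃ A : Finset (Fin l), S₀ = A.biUnion P

/-- `X 0, …, X (n - 1)` are pairwise disjoint nonempty subsets of `T`. -/
def IsDisjointFamily {n : ℕ} (X : Fin n → Finset T) : Prop :=
  (∀ j, (X j).Nonempty) ∧ ∀ i j, i ≠ j → Disjoint (X i) (X j)

/-- `g_{S₁}(t) = min {|S₁ \ Γ_{G₀}(t)|, g(t)}`. -/
def gRestrict (E₀ : Finset (S × T)) (g : T → ℕ) (S₁ : Finset S) (t : T) : ℕ :=
  min (S₁ \ nbr E₀ {t}).card (g t)

/-- `E` is a set of new edges such that `E ∪ E₀` is simple and covers `p` (with respect to `ρ`),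
`f₁(α) ≤ ∑_{s ∈ P_α} d_E(s) ≤ f₂(α)` for all `α`, and `d_E(t) ≤ g(t)` for all `t ∈ T`. -/
def IsGoodAugmentation (ρ : Finset S → ℕ) (E₀ : Finset (S × T)) (p : Finset T → ℤ) {l : ℕ}
    (P : Fin l → Finset S) (f₁ f₂ : Fin l → ℕ) (g : T → ℕ) (E : Finset (S × T)) : Prop :=
  (Disjoint E E₀ ∧ Covers ρ (E ∪ E₀) p) ∧
  (∀ α, f₁ α ≤ ∑ s ∈ P α, degS E s ∧ ∑ s ∈ P α, degS E s ≤ f₂ α) ∧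
  (∀ t, degT E t ≤ g t)

/-- The inequality involving the lower bounds `f₁`, for `S₀ ⊆ S` and `X 0, …, X (n - 1) ⊆ T`. -/
def LowerIneq (ρ : Finset S → ℕ) (E₀ : Finset (S × T)) (p : Finset T → ℤ) {l : ℕ}
    (P : Fin l → Finset S) (f₁ : Fin l → ℕ) (g : T → ℕ)
    {n : ℕ} (X : Fin n → Finset T) (S₀ : Finset S) : Prop :=
  (∑ j, p (X j)) + (∑ α with P α ⊆ S₀ᶜ, (f₁ α : ℤ))
      - (∑ t ∈ Finset.univ \ Finset.univ.biUnion X, (gRestrict E₀ g S₀ᶜ t : ℤ))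
    ≤ ∑ j, ((ρ (S₀ᶜ ∪ nbr E₀ (X j)) : ℤ) + ∑ t ∈ X j, (g t : ℤ))

/-- The inequality involving the upper bounds `f₂`, for `S₀ ⊆ S` and `X 0, …, X (n - 1) ⊆ T`. -/
def UpperIneq (ρ : Finset S → ℕ) (E₀ : Finset (S × T)) (p : Finset T → ℤ) {l : ℕ}
    (P : Fin l → Finset S) (f₂ : Fin l → ℕ)
    {n : ℕ} (X : Fin n → Finset T) (S₀ : Finset S) : Prop :=
  ∑ j, (p (X j) - (ρ (S₀ᶜ ∪ nbr E₀ (X j)) : ℤ)) ≤ ∑ α with P α ⊆ S₀, (f₂ α : ℤ)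

end

end BipCover

set_option linter.unusedSectionVars false

namespace BipCover

/-! ### Disjoint families of subsets of `T` and the uncrossing of two of them. -/

section Families

variable {T K : Type*} [DecidableEq T] [DecidableEq K]

/-! Necessity counts edges of `E`. Passing from `S₀ᶜ ∪ nbr E₀ X` to a set containing all neighbours
of `X` in `E ∪ E₀` raises the rank by at most the number of added vertices, and each of these lies
in `S₀` and receives an edge of `E` from `X`. Summing over a disjoint family gives the upper
inequality; counting the edges that enter `S₀ᶜ` gives the lower one.

For sufficiency, a dummy vertex `none` is added to `S` to absorb the unused degree, so that every
`t` has degree exactly `g t`. Covering `p` and simplicity then both become lower bounds on the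
number of edges between some `X ⊆ T` and some `Y ⊆ S ∪ {none}`. Their maximum, `demand`, is monotone
in `Y` and supermodular in a mixed sense (`isDemand_demand`), and the two inequalities bound its
total over any disjoint family at any union of classes (`tot_demand_le_border`).

Two general facts about such demands finish the proof, both by uncrossing disjoint families
(`IsDemand.uncrosses`). The bounds `f₁ ≤ f₂` can be closed up, one unit at a time, to exact class
degrees (`exists_exact`). Then a covering multigraph is built edge by edge (`exists_cover`); the
heart is `exists_fits_residual`, where extremal tight sets show where the next edge can go. Since
the total degrees on both sides agree, all degree bounds of the multigraph are equalities, and the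
demands then force it to be simple and disjoint from `E₀`. -/

/-- A family of pairwise disjoint nonempty sets. -/
def IsFam (F : Finset (Finset T)) : Prop :=
  (∀ X ∈ F, X.Nonempty) ∧ ∀ X ∈ F, ∀ X' ∈ F, X ≠ X' → Disjoint X X'

theorem IsFam.subset {F F' : Finset (Finset T)} (h : IsFam F) (hs : F' ⊆ F) : IsFam F' :=
  ⟨fun X hX => h.1 X (hs hX), fun X hX X' hX' => h.2 X (hs hX) X' (hs hX')⟩

theorem IsFam.erase {F : Finset (Finset T)} (h : IsFam F) (X : Finset T) : IsFam (F.erase X) :=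
  h.subset (Finset.erase_subset _ _)

theorem isFam_empty : IsFam (∅ : Finset (Finset T)) := by
  simp [IsFam]

/-- The set of points covered by a family. -/
def cov (F : Finset (Finset T)) : Finset T := F.biUnion id

theorem mem_cov {F : Finset (Finset T)} {t : T} : t ∈ cov F ↔ ∃ X ∈ F, t ∈ X := by
  simp [cov]

theorem subset_cov {F : Finset (Finset T)} {X : Finset T} (h : X ∈ F) : X ⊆ cov F :=
  fun _ ht => mem_cov.2 ⟨X, h, ht⟩

theorem cov_mono {F F' : Finset (Finset T)} (h : F ⊆ F') : cov F ⊆ cov F' :=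
  Finset.biUnion_subset_biUnion_of_subset_left _ h

theorem cov_insert (F : Finset (Finset T)) (X : Finset T) : cov (insert X F) = X ∪ cov F := by
  simp [cov, Finset.biUnion_insert]

theorem IsFam.disjoint_cov_erase {F : Finset (Finset T)} (h : IsFam F) {X : Finset T}
    (hX : X ∈ F) : Disjoint X (cov (F.erase X)) := by
  rw [Finset.disjoint_left]
  intro t ht htc
  obtain ⟨X', hX', ht'⟩ := mem_cov.1 htc
  rw [Finset.mem_erase] at hX'
  exact Finset.disjoint_left.1 (h.2 X hX X' hX'.2 (Ne.symm hX'.1)) ht ht'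

theorem IsFam.insert {F : Finset (Finset T)} (h : IsFam F) {X : Finset T} (hX : X.Nonempty)
    (hd : Disjoint X (cov F)) : IsFam (insert X F) := by
  have hd' : ∀ X' ∈ F, Disjoint X X' := fun X' hX' => hd.mono_right (subset_cov hX')
  refine ⟨?_, ?_⟩
  · intro X' hX'
    rcases Finset.mem_insert.1 hX' with rfl | h'
    · exact hX
    · exact h.1 X' h'
  · intro A hA B hB hne
    rcases Finset.mem_insert.1 hA with rfl | hA' <;> rcases Finset.mem_insert.1 hB with rfl | hB'
    · exact absurd rfl hne
    · exact hd' B hB'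
    · exact (hd' A hA').symm
    · exact h.2 A hA' B hB' hne

theorem notMem_of_disjoint_cov {F : Finset (Finset T)} {X : Finset T} (hX : X.Nonempty)
    (hd : Disjoint X (cov F)) : X ∉ F := by
  intro h
  obtain ⟨t, ht⟩ := hX
  exact Finset.disjoint_left.1 hd ht (subset_cov h ht)

/-- The total demand of a family at `Y`. -/
def tot (q : Finset T → Finset K → ℤ) (F : Finset (Finset T)) (Y : Finset K) : ℤ :=
  ∑ X ∈ F, q X Y

theorem tot_insert (q : Finset T → Finset K → ℤ) {F : Finset (Finset T)} {X : Finset T}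
    (Y : Finset K) (h : X ∉ F) : tot q (insert X F) Y = q X Y + tot q F Y :=
  Finset.sum_insert h

theorem tot_erase (q : Finset T → Finset K → ℤ) {F : Finset (Finset T)} {X : Finset T}
    (Y : Finset K) (h : X ∈ F) : tot q F Y = q X Y + tot q (F.erase X) Y :=
  (Finset.add_sum_erase _ _ h).symm

/-- Monotone demand functions that are supermodular on intersecting pairs of positive demand. -/
structure IsDemand (q : Finset T → Finset K → ℤ) : Prop where
  mono : ∀ X Y Y', Y ⊆ Y' → q X Y ≤ q X Y'
  sup : ∀ X X' Y Y', (X ∩ X').Nonempty → 0 < q X Y → 0 < q X' Y' →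
    q X Y + q X' Y' ≤ q (X ∪ X') (Y ∩ Y') + q (X ∩ X') (Y ∪ Y')

variable {q : Finset T → Finset K → ℤ}

theorem IsDemand.tot_mono (hq : IsDemand q) (F : Finset (Finset T)) {Y Y' : Finset K}
    (h : Y ⊆ Y') : tot q F Y ≤ tot q F Y' :=
  Finset.sum_le_sum fun X _ => hq.mono X Y Y' h

theorem tot_le_tot_filter_pos (q : Finset T → Finset K → ℤ) (F : Finset (Finset T))
    (Y : Finset K) : tot q F Y ≤ tot q (F.filter fun X => 0 < q X Y) Y := by
  unfold tot
  rw [← Finset.sum_filter_add_sum_filter_not F (fun X => 0 < q X Y)]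
  have : ∑ X ∈ F with ¬ 0 < q X Y, q X Y ≤ 0 :=
    Finset.sum_nonpos fun X hX => not_lt.1 (Finset.mem_filter.1 hX).2
  linarith

/-- The uncrossing properties of two families, with or without a further set `B`, demanded at
`Y ∩ Y'`, that absorbs the members it meets. -/
def Uncrosses (q : Finset T → Finset K → ℤ) (Y Y' : Finset K) (F F' : Finset (Finset T)) : Prop :=
  (∃ M N, IsFam M ∧ IsFam N ∧ cov M ⊆ cov F ∪ cov F' ∧ cov N ⊆ cov F ∪ cov F' ∧
    tot q F Y + tot q F' Y' ≤ tot q M (Y ∩ Y') + tot q N (Y ∪ Y')) ∧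
  ∀ B : Finset T, B.Nonempty → 0 < q B (Y ∩ Y') → Disjoint B (cov F ∩ cov F') →
    ∃ M N, IsFam M ∧ IsFam N ∧ cov M ⊆ B ∪ (cov F ∪ cov F') ∧
      ((∃ C ∈ M, B ⊆ C) ∨ cov M ⊆ cov F ∪ cov F') ∧ cov N ⊆ cov F ∪ cov F' ∧
      tot q F Y + tot q F' Y' + q B (Y ∩ Y') ≤ tot q M (Y ∩ Y') + tot q N (Y ∪ Y')

/-- `I` is disjoint from everything in sight and simply joins `N`. If `B` has positive demand it is
absorbed into `M`; otherwise leaving it out loses nothing. -/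
theorem Uncrosses.add_pair {Y Y' : Finset K} {F F' : Finset (Finset T)}
    (h : Uncrosses q Y Y' F F') {B I : Finset T} (hB : B.Nonempty) (hI : I.Nonempty)
    (hBd : Disjoint B (cov F ∩ cov F')) (hId : Disjoint I (cov F ∪ cov F')) :
    ∃ M N, IsFam M ∧ IsFam N ∧ cov M ⊆ B ∪ (cov F ∪ cov F') ∧
      ((∃ C ∈ M, B ⊆ C) ∨ cov M ⊆ cov F ∪ cov F') ∧ cov N ⊆ I ∪ (cov F ∪ cov F') ∧
      tot q F Y + tot q F' Y' + (q B (Y ∩ Y') + q I (Y ∪ Y'))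
        ≤ tot q M (Y ∩ Y') + tot q N (Y ∪ Y') := by
  have hins : ∀ N, IsFam N → cov N ⊆ cov F ∪ cov F' →
      IsFam (insert I N) ∧ cov (insert I N) ⊆ I ∪ (cov F ∪ cov F') ∧
        tot q (insert I N) (Y ∪ Y') = q I (Y ∪ Y') + tot q N (Y ∪ Y') := by
    intro N hN hc
    have hd := hId.mono_right hc
    refine ⟨hN.insert hI hd, ?_, tot_insert q _ (notMem_of_disjoint_cov hI hd)⟩
    rw [cov_insert]
    exact Finset.union_subset_union_right hc
  by_cases hpos : 0 < q B (Y ∩ Y')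
  · obtain ⟨M, N, hM, hN, hcM, hC, hcN, hle⟩ := h.2 B hB hpos hBd
    obtain ⟨h1, h2, h3⟩ := hins N hN hcN
    exact ⟨M, insert I N, hM, h1, hcM, hC, h2, by linarith⟩
  · obtain ⟨M, N, hM, hN, hcM, hcN, hle⟩ := h.1
    obtain ⟨h1, h2, h3⟩ := hins N hN hcN
    exact ⟨M, insert I N, hM, h1, hcM.trans Finset.subset_union_right, Or.inr hcM, h2,
      by linarith⟩

theorem cov_erase_subset {F : Finset (Finset T)} (X : Finset T) :
    cov (F.erase X) ⊆ cov F := cov_mono (Finset.erase_subset _ _)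

/-- Supermodularity trades `A` at `Y` and `A'` at `Y'` for `A ∪ A'` at `Y ∩ Y'` and `A ∩ A'` at `Y ∪
Y'`. Disjointness within each family makes this new pair admissible for `add_pair`. -/
theorem Uncrosses.pair (hq : IsDemand q) {Y Y' : Finset K} {F F' : Finset (Finset T)}
    {A A' : Finset T} (h : Uncrosses q Y Y' (F.erase A) (F'.erase A'))
    (hF : IsFam F) (hF' : IsFam F') (hA : A ∈ F) (hA' : A' ∈ F') (hAA' : (A ∩ A').Nonempty)
    (hpA : 0 < q A Y) (hpA' : 0 < q A' Y') :
    ∃ M N, IsFam M ∧ IsFam N ∧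
      cov M ⊆ (A ∪ A') ∪ (cov (F.erase A) ∪ cov (F'.erase A')) ∧
      ((∃ C ∈ M, A ∪ A' ⊆ C) ∨ cov M ⊆ cov (F.erase A) ∪ cov (F'.erase A')) ∧
      cov N ⊆ (A ∩ A') ∪ (cov (F.erase A) ∪ cov (F'.erase A')) ∧
      tot q F Y + tot q F' Y' ≤ tot q M (Y ∩ Y') + tot q N (Y ∪ Y') := by
  have hdA := Finset.disjoint_left.1 (hF.disjoint_cov_erase hA)
  have hdA' := Finset.disjoint_left.1 (hF'.disjoint_cov_erase hA')
  have hs := hq.sup A A' Y Y' hAA' hpA hpA'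
  have e1 := tot_erase q Y hA
  have e2 := tot_erase q Y' hA'
  have hU : (A ∪ A').Nonempty := (hF.1 A hA).mono Finset.subset_union_left
  obtain ⟨M, N, hM, hN, h1, h2, h3, h4⟩ := h.add_pair hU hAA'
    (by rw [Finset.disjoint_left]; intro t; have := @hdA t; have := @hdA' t
        simp only [Finset.mem_union, Finset.mem_inter]; tauto)
    (by rw [Finset.disjoint_left]; intro t; have := @hdA t; have := @hdA' t
        simp only [Finset.mem_union, Finset.mem_inter]; tauto)
  exact ⟨M, N, hM, hN, h1, h2, h3, by linarith⟩

theorem Uncrosses.absorb_member {Y Y' : Finset K} {F F' : Finset (Finset T)}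
    (h : Uncrosses q Y Y' F F') {A B W : Finset T} {c : ℤ} (hB : B.Nonempty)
    (hBA : (B ∩ A).Nonempty) (hd : Disjoint (B ∪ A) (cov F ∩ cov F'))
    (hd' : Disjoint (B ∩ A) (cov F ∪ cov F')) (hAW : A ⊆ W) (hW : cov F ∪ cov F' ⊆ W)
    (hc : c ≤ tot q F Y + tot q F' Y' + (q (B ∪ A) (Y ∩ Y') + q (B ∩ A) (Y ∪ Y'))) :
    ∃ M N, IsFam M ∧ IsFam N ∧ cov M ⊆ B ∪ W ∧ ((∃ C ∈ M, B ⊆ C) ∨ cov M ⊆ W) ∧ cov N ⊆ W ∧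
      c ≤ tot q M (Y ∩ Y') + tot q N (Y ∪ Y') := by
  obtain ⟨M, N, hM, hN, h1, h2, h3, h4⟩ :=
    h.add_pair (hB.mono Finset.subset_union_left) hBA hd hd'
  refine ⟨M, N, hM, hN, h1.trans ?_, ?_, h3.trans ?_, hc.trans h4⟩
  · exact Finset.union_subset (Finset.union_subset_union_right hAW)
      (hW.trans Finset.subset_union_right)
  · rcases h2 with ⟨C, hC, hBC⟩ | h2
    · exact Or.inl ⟨C, hC, Finset.subset_union_left.trans hBC⟩
    · exact Or.inr (h2.trans hW)
  · exact Finset.union_subset (Finset.inter_subset_right.trans hAW) hW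

/-- Strong induction on the total number of members. A meeting pair is replaced by its union and
intersection, and the union then plays the role of `B` for the smaller families. An absorbing `B` in
turn swallows the members it meets one by one. The condition that `B` avoids `cov F ∩ cov F'` keeps
each leftover `B ∩ A` disjoint from the remaining members. -/
theorem IsDemand.uncrosses_aux (hq : IsDemand q) (Y Y' : Finset K) (n : ℕ) :
    ∀ F F' : Finset (Finset T), F.card + F'.card = n → IsFam F → IsFam F' →
      (∀ X ∈ F, 0 < q X Y) → (∀ X ∈ F', 0 < q X Y') → Uncrosses q Y Y' F F' := by
  induction n using Nat.strong_induction_on with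
  | _ n ih =>
  intro F F' hn hF hF' hpF hpF'
  have hYU : Y ⊆ Y ∪ Y' := Finset.subset_union_left
  have hYU' : Y' ⊆ Y ∪ Y' := Finset.subset_union_right
  have base : ∃ M N, IsFam M ∧ IsFam N ∧ cov M ⊆ cov F ∪ cov F' ∧ cov N ⊆ cov F ∪ cov F' ∧
        tot q F Y + tot q F' Y' ≤ tot q M (Y ∩ Y') + tot q N (Y ∪ Y') := by
    by_cases hmeet : ∃ A ∈ F, ∃ A' ∈ F', (A ∩ A').Nonempty
    · obtain ⟨A, hA, A', hA', hAA'⟩ := hmeet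
      have hlt : (F.erase A).card + (F'.erase A').card < n := by
        have := Finset.card_erase_lt_of_mem hA
        have := Finset.card_erase_le (s := F') (a := A')
        omega
      obtain ⟨M, N, hM, hN, h1, -, h3, h4⟩ :=
        (ih _ hlt (F.erase A) (F'.erase A') rfl (hF.erase A) (hF'.erase A')
          (fun X hX => hpF X (Finset.mem_of_mem_erase hX))
          (fun X hX => hpF' X (Finset.mem_of_mem_erase hX))).pair hq hF hF' hA hA' hAA'
          (hpF A hA) (hpF' A' hA')
      have hsub : ∀ Z, Z ⊆ A ∪ A' → Z ∪ (cov (F.erase A) ∪ cov (F'.erase A')) ⊆ cov F ∪ cov F' := by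
        intro Z hZ
        refine Finset.union_subset (hZ.trans ?_) ?_
        · exact Finset.union_subset_union (subset_cov hA) (subset_cov hA')
        · exact Finset.union_subset_union (cov_erase_subset A) (cov_erase_subset A')
      exact ⟨M, N, hM, hN, h1.trans (hsub _ subset_rfl),
        h3.trans (hsub _ (Finset.inter_subset_left.trans Finset.subset_union_left)), h4⟩
    -- When no members meet, `F ∪ F'` is itself a disjoint family, and monotonicity lets all of it
    -- be demanded at `Y ∪ Y'`, with nothing at `Y ∩ Y'`.
    · have hd : ∀ X ∈ F, ∀ X' ∈ F', Disjoint X X' := by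
        intro X hX X' hX'
        by_contra hc
        exact hmeet ⟨X, hX, X', hX', Finset.not_disjoint_iff_nonempty_inter.1 hc⟩
      have hFF' : Disjoint F F' := by
        rw [Finset.disjoint_left]
        intro X hX hX'
        exact (hF.1 X hX).ne_empty (disjoint_self.1 (hd X hX X hX'))
      refine ⟨∅, F ∪ F', isFam_empty, ⟨?_, ?_⟩, by simp [cov], ?_, ?_⟩
      · intro X hX
        exact (Finset.mem_union.1 hX).elim (hF.1 X) (hF'.1 X)
      · intro X hX X' hX' hne
        rcases Finset.mem_union.1 hX with h | h <;> rcases Finset.mem_union.1 hX' with h' | h'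
        · exact hF.2 X h X' h' hne
        · exact hd X h X' h'
        · exact (hd X' h' X h).symm
        · exact hF'.2 X h X' h' hne
      · intro t ht
        obtain ⟨X, hX, htX⟩ := mem_cov.1 ht
        rcases Finset.mem_union.1 hX with h | h
        · exact Finset.mem_union_left _ (subset_cov h htX)
        · exact Finset.mem_union_right _ (subset_cov h htX)
      · have h1 := hq.tot_mono F hYU
        have h2 := hq.tot_mono F' hYU'
        have h3 : tot q (F ∪ F') (Y ∪ Y') = tot q F (Y ∪ Y') + tot q F' (Y ∪ Y') :=
          Finset.sum_union hFF'
        have h4 : tot q ∅ (Y ∩ Y') = 0 := Finset.sum_empty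
        linarith
  refine ⟨base, ?_⟩
  intro B hB hpB hBd
  have hBd' : ∀ ⦃t⦄, t ∈ B → ¬ (t ∈ cov F ∧ t ∈ cov F') := fun t ht h =>
    Finset.disjoint_left.1 hBd ht (Finset.mem_inter.2 h)
  by_cases hm : ∃ A ∈ F, (B ∩ A).Nonempty
  · obtain ⟨A, hA, hBA⟩ := hm
    have hlt : (F.erase A).card + F'.card < n := by
      have := Finset.card_erase_lt_of_mem hA
      omega
    have hdA := hF.disjoint_cov_erase hA
    have hAc := subset_cov hA
    have hce := cov_erase_subset (F := F) A
    have hs := hq.sup B A (Y ∩ Y') Y hBA hpB (hpF A hA)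
    rw [Finset.inter_right_comm, Finset.inter_self] at hs
    have hs' := hq.mono (B ∩ A) (Y ∩ Y' ∪ Y) (Y ∪ Y')
      (Finset.union_subset (Finset.inter_subset_left.trans hYU) hYU)
    have e1 := tot_erase q Y hA
    refine (ih _ hlt (F.erase A) F' rfl (hF.erase A) hF'
      (fun X hX => hpF X (Finset.mem_of_mem_erase hX)) hpF').absorb_member (A := A) hB hBA
      (Finset.disjoint_union_left.2 ⟨hBd.mono_right (Finset.inter_subset_inter_right hce),
        hdA.mono_right Finset.inter_subset_left⟩)
      (Finset.disjoint_union_right.2 ⟨hdA.mono_left Finset.inter_subset_right, ?_⟩)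
      (hAc.trans Finset.subset_union_left) (Finset.union_subset_union_left hce) (by linarith)
    rw [Finset.disjoint_left]
    intro t ht ht'
    rw [Finset.mem_inter] at ht
    exact hBd' ht.1 ⟨hAc ht.2, ht'⟩
  by_cases hm' : ∃ A ∈ F', (B ∩ A).Nonempty
  · obtain ⟨A, hA, hBA⟩ := hm'
    have hlt : F.card + (F'.erase A).card < n := by
      have := Finset.card_erase_lt_of_mem hA
      omega
    have hdA := hF'.disjoint_cov_erase hA
    have hAc := subset_cov hA
    have hce := cov_erase_subset (F := F') A
    have hs := hq.sup B A (Y ∩ Y') Y' hBA hpB (hpF' A hA)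
    rw [Finset.inter_assoc, Finset.inter_self] at hs
    have hs' := hq.mono (B ∩ A) (Y ∩ Y' ∪ Y') (Y ∪ Y')
      (Finset.union_subset (Finset.inter_subset_left.trans hYU) hYU')
    have e1 := tot_erase q Y' hA
    refine (ih _ hlt F (F'.erase A) rfl hF (hF'.erase A) hpF
      (fun X hX => hpF' X (Finset.mem_of_mem_erase hX))).absorb_member (A := A) hB hBA
      (Finset.disjoint_union_left.2 ⟨hBd.mono_right (Finset.inter_subset_inter_left hce),
        hdA.mono_right Finset.inter_subset_right⟩)
      (Finset.disjoint_union_right.2 ⟨?_, hdA.mono_left Finset.inter_subset_right⟩)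
      (hAc.trans Finset.subset_union_right) (Finset.union_subset_union_right hce) (by linarith)
    rw [Finset.disjoint_left]
    intro t ht ht'
    rw [Finset.mem_inter] at ht
    exact hBd' ht.1 ⟨ht', hAc ht.2⟩
  obtain ⟨M, N, hM, hN, hcM, hcN, hle⟩ := base
  have hd : Disjoint B (cov F ∪ cov F') := by
    rw [Finset.disjoint_left]
    intro t ht htc
    rcases Finset.mem_union.1 htc with h | h <;> obtain ⟨X, hX, htX⟩ := mem_cov.1 h
    · exact hm ⟨X, hX, t, Finset.mem_inter.2 ⟨ht, htX⟩⟩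
    · exact hm' ⟨X, hX, t, Finset.mem_inter.2 ⟨ht, htX⟩⟩
  have hd' := hd.mono_right hcM
  refine ⟨insert B M, N, hM.insert hB hd', hN, ?_,
    Or.inl ⟨B, Finset.mem_insert_self _ _, subset_rfl⟩, hcN, ?_⟩
  · rw [cov_insert]
    exact Finset.union_subset_union_right hcM
  · rw [tot_insert q _ (notMem_of_disjoint_cov hB hd')]
    linarith

theorem IsDemand.uncrosses (hq : IsDemand q) {Y Y' : Finset K} {F F' : Finset (Finset T)}
    (hF : IsFam F) (hF' : IsFam F') (hpF : ∀ X ∈ F, 0 < q X Y) (hpF' : ∀ X ∈ F', 0 < q X Y') :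
    Uncrosses q Y Y' F F' :=
  hq.uncrosses_aux Y Y' _ F F' rfl hF hF' hpF hpF'

theorem IsDemand.uncross_pair (hq : IsDemand q) {Y Y' : Finset K} {F F' : Finset (Finset T)}
    {A A' : Finset T} (hF : IsFam F) (hF' : IsFam F') (hpF : ∀ X ∈ F, 0 < q X Y)
    (hpF' : ∀ X ∈ F', 0 < q X Y') (hA : A ∈ F) (hA' : A' ∈ F') (hAA' : (A ∩ A').Nonempty) :
    ∃ M N, IsFam M ∧ IsFam N ∧
      ((∃ C ∈ M, A ∪ A' ⊆ C) ∨ cov M ⊆ cov (F.erase A) ∪ cov (F'.erase A')) ∧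
      cov N ⊆ (A ∩ A') ∪ (cov (F.erase A) ∪ cov (F'.erase A')) ∧
      tot q F Y + tot q F' Y' ≤ tot q M (Y ∩ Y') + tot q N (Y ∪ Y') := by
  obtain ⟨M, N, hM, hN, -, h⟩ := (hq.uncrosses (hF.erase A) (hF'.erase A')
    (fun X hX => hpF X (Finset.mem_of_mem_erase hX))
    (fun X hX => hpF' X (Finset.mem_of_mem_erase hX))).pair hq hF hF' hA hA' hAA'
    (hpF A hA) (hpF' A' hA')
  exact ⟨M, N, hM, hN, h⟩

end Families

/-! ### Covering a demand function by a multigraph with prescribed class degrees. -/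

section Covering

variable {T K I : Type*} [Fintype T] [DecidableEq T] [Fintype K] [DecidableEq K] [Fintype I]
  [DecidableEq I]

/-- The union of the classes with index in `A`. -/
def pre (c : K → I) (A : Finset I) : Finset K := Finset.univ.filter fun k => c k ∈ A

@[simp] theorem mem_pre {c : K → I} {A : Finset I} {k : K} : k ∈ pre c A ↔ c k ∈ A := by
  simp [pre]

theorem pre_inter (c : K → I) (A B : Finset I) : pre c (A ∩ B) = pre c A ∩ pre c B := by
  ext; simp

theorem pre_union (c : K → I) (A B : Finset I) : pre c (A ∪ B) = pre c A ∪ pre c B := by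
  ext; simp

theorem pre_mono (c : K → I) {A B : Finset I} (h : A ⊆ B) : pre c A ⊆ pre c B :=
  fun _ hk => mem_pre.2 (h (mem_pre.1 hk))

variable {q : Finset T → Finset K → ℤ} {c : K → I} {m : I → ℕ}

/-- No disjoint family demands more at a union of classes than `m` allows. -/
def Fits (q : Finset T → Finset K → ℤ) (c : K → I) (m : I → ℕ) : Prop :=
  ∀ (A : Finset I) (F : Finset (Finset T)), IsFam F → tot q F (pre c A) ≤ ∑ i ∈ A, (m i : ℤ)

/-- A family of positive demands that uses up all that `m` allows. -/
structure Tight (q : Finset T → Finset K → ℤ) (c : K → I) (m : I → ℕ) (A : Finset I)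
    (F : Finset (Finset T)) : Prop where
  fam : IsFam F
  pos : ∀ X ∈ F, 0 < q X (pre c A)
  le : ∑ i ∈ A, (m i : ℤ) ≤ tot q F (pre c A)

/-- Some tight family at `A` avoids `t`. -/
def TightAvoiding (q : Finset T → Finset K → ℤ) (c : K → I) (m : I → ℕ) (t : T)
    (A : Finset I) : Prop :=
  ∃ F, Tight q c m A F ∧ t ∉ cov F

theorem Tight.of_le {A : Finset I} {F : Finset (Finset T)} (hF : IsFam F)
    (h : ∑ i ∈ A, (m i : ℤ) ≤ tot q F (pre c A)) :
    Tight q c m A (F.filter fun X => 0 < q X (pre c A)) :=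
  ⟨hF.subset (Finset.filter_subset _ _), fun _ hX => (Finset.mem_filter.1 hX).2,
    h.trans (tot_le_tot_filter_pos q F _)⟩

theorem TightAvoiding.of_le {t : T} {A : Finset I} {F : Finset (Finset T)} (hF : IsFam F)
    (h : ∑ i ∈ A, (m i : ℤ) ≤ tot q F (pre c A)) (ht : t ∉ cov F) : TightAvoiding q c m t A :=
  ⟨_, Tight.of_le hF h, fun h' => ht (cov_mono (Finset.filter_subset _ _) h')⟩

theorem sum_inter_add_sum_union (m : I → ℕ) (A B : Finset I) :
    ∑ i ∈ A ∩ B, (m i : ℤ) + ∑ i ∈ A ∪ B, (m i : ℤ) = ∑ i ∈ A, (m i : ℤ) + ∑ i ∈ B, (m i : ℤ) := by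
  rw [add_comm, Finset.sum_union_inter]

/-- After uncrossing, `M` can use at most the allowance of `A ∩ B`, so `N` uses up that of `A ∪ B`;
and `N` covers no new points. -/
theorem TightAvoiding.union (hq : IsDemand q) (hm : Fits q c m) {t : T} {A B : Finset I}
    (hA : TightAvoiding q c m t A) (hB : TightAvoiding q c m t B) :
    TightAvoiding q c m t (A ∪ B) := by
  obtain ⟨F, hF, htF⟩ := hA
  obtain ⟨F', hF', htF'⟩ := hB
  obtain ⟨M, N, hM, hN, -, hcN, hle⟩ := (hq.uncrosses hF.fam hF'.fam hF.pos hF'.pos).1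
  rw [← pre_inter, ← pre_union] at hle
  have h1 := hm (A ∩ B) M hM
  have h2 := sum_inter_add_sum_union m A B
  have h3 := hF.le
  have h4 := hF'.le
  refine TightAvoiding.of_le hN (by linarith) fun h => ?_
  rcases Finset.mem_union.1 (hcN h) with h | h
  · exact htF h
  · exact htF' h

/-- If a member containing `t` of a tight family meets a tight family avoiding `t`, then the union
is tight avoiding `t`. -/
theorem Tight.union_tightAvoiding (hq : IsDemand q) (hm : Fits q c m) {t : T} {A B : Finset I}
    {F F' : Finset (Finset T)} (hF : Tight q c m A F) (hF' : Tight q c m B F') {X : Finset T}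
    (hX : X ∈ F) (htX : t ∈ X) (htF' : t ∉ cov F') (hXF' : ¬ Disjoint X (cov F')) :
    TightAvoiding q c m t (A ∪ B) := by
  obtain ⟨u, hu, huF'⟩ := Finset.not_disjoint_iff.1 hXF'
  obtain ⟨X', hX', huX'⟩ := mem_cov.1 huF'
  obtain ⟨M, N, hM, hN, -, hcN, hle⟩ := hq.uncross_pair hF.fam hF'.fam hF.pos hF'.pos hX hX'
    ⟨u, Finset.mem_inter.2 ⟨hu, huX'⟩⟩
  rw [← pre_inter, ← pre_union] at hle
  have h1 := hm (A ∩ B) M hM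
  have h2 := sum_inter_add_sum_union m A B
  have h3 := hF.le
  have h4 := hF'.le
  refine TightAvoiding.of_le hN (by linarith) fun h => ?_
  rcases Finset.mem_union.1 (hcN h) with h | h
  · exact htF' (subset_cov hX' (Finset.mem_inter.1 h).2)
  rcases Finset.mem_union.1 h with h | h
  · exact Finset.disjoint_left.1 (hF.fam.disjoint_cov_erase hX) htX h
  · exact htF' (cov_erase_subset X' h)

/-- If a member of a tight family avoids another tight family, then it is in a tight family of the
union, and its demand does not increase. -/
theorem Tight.union_of_disjoint (hq : IsDemand q) (hm : Fits q c m) {A B : Finset I}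
    {F F' : Finset (Finset T)} (hF : Tight q c m A F) (hF' : Tight q c m B F') {X : Finset T}
    (hX : X ∈ F) (hXF' : Disjoint X (cov F')) :
    (∃ N, Tight q c m (A ∪ B) N ∧ X ∈ N) ∧ q X (pre c (A ∪ B)) ≤ q X (pre c A) := by
  have hne := hF.fam.1 X hX
  obtain ⟨M, N, hM, hN, -, hcN, hle⟩ := (hq.uncrosses (hF.fam.erase X) hF'.fam
    (fun Z hZ => hF.pos Z (Finset.mem_of_mem_erase hZ)) hF'.pos).1
  rw [← pre_inter, ← pre_union] at hle
  have hXN : Disjoint X (cov N) :=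
    (Finset.disjoint_union_right.2 ⟨hF.fam.disjoint_cov_erase hX, hXF'⟩).mono_right hcN
  have hN' := hN.insert hne hXN
  have h1 := hm (A ∩ B) M hM
  have h2 := sum_inter_add_sum_union m A B
  have h3 := hF.le
  have h4 := hF'.le
  have h5 := tot_erase q (pre c A) hX
  have h6 := hm (A ∪ B) _ hN'
  have h7 := tot_insert q (pre c (A ∪ B)) (notMem_of_disjoint_cov hne hXN)
  have h8 := hq.mono X _ _ (pre_mono c (Finset.subset_union_left (s₁ := A) (s₂ := B)))
  have h9 := hF.pos X hX
  refine ⟨⟨_, Tight.of_le hN' (by linarith), ?_⟩, by linarith⟩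
  exact Finset.mem_filter.2 ⟨Finset.mem_insert_self _ _, by linarith⟩

/-- Uncrossing two tight families with members containing `t`. -/
theorem Tight.inter (hq : IsDemand q) (hm : Fits q c m) {t : T} {A B : Finset I}
    {F F' : Finset (Finset T)} (hF : Tight q c m A F) (hF' : Tight q c m B F') {X X' : Finset T}
    (hX : X ∈ F) (hX' : X' ∈ F') (ht : t ∈ X) (ht' : t ∈ X') :
    TightAvoiding q c m t (A ∩ B) ∨ ∃ M C, Tight q c m (A ∩ B) M ∧ C ∈ M ∧ X ∪ X' ⊆ C := by
  obtain ⟨M, N, hM, hN, hC, -, hle⟩ := hq.uncross_pair hF.fam hF'.fam hF.pos hF'.pos hX hX'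
    ⟨t, Finset.mem_inter.2 ⟨ht, ht'⟩⟩
  rw [← pre_inter, ← pre_union] at hle
  have h1 := hm (A ∪ B) N hN
  have h2 := sum_inter_add_sum_union m A B
  have h3 := hF.le
  have h4 := hF'.le
  have h5 : ∑ i ∈ A ∩ B, (m i : ℤ) ≤ tot q M (pre c (A ∩ B)) := by linarith
  rcases hC with ⟨C, hC, hXC⟩ | hC
  · have htC : t ∈ C := hXC (Finset.mem_union_left _ ht)
    by_cases hpos : 0 < q C (pre c (A ∩ B))
    · exact Or.inr ⟨_, C, Tight.of_le hM h5, Finset.mem_filter.2 ⟨hC, hpos⟩, hXC⟩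
    -- `C` is the only member of `M` containing `t`; as its demand is not positive, the filter
    -- removes it.
    · refine Or.inl ⟨_, Tight.of_le hM h5, fun h => ?_⟩
      obtain ⟨Z, hZ, htZ⟩ := mem_cov.1 h
      rw [Finset.mem_filter] at hZ
      by_cases hZC : Z = C
      · exact hpos (hZC ▸ hZ.2)
      · exact Finset.disjoint_left.1 (hM.2 Z hZ.1 C hC hZC) htZ htC
  · refine Or.inl (TightAvoiding.of_le hM h5 fun h => ?_)
    rcases Finset.mem_union.1 (hC h) with h | h
    · exact Finset.disjoint_left.1 (hF.fam.disjoint_cov_erase hX) ht h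
    · exact Finset.disjoint_left.1 (hF'.fam.disjoint_cov_erase hX') ht' h

/-- For fixed `X`, positive demand is supermodular in `Y`, so deletions that are harmless one at a
time are harmless together. -/
theorem IsDemand.le_sdiff (hq : IsDemand q) {X : Finset T} (hX : X.Nonempty) {Y : Finset K}
    (hpos : 0 < q X Y) (Z : Finset K) (hZ : ∀ k ∈ Z, q X Y ≤ q X (Y.erase k)) :
    q X Y ≤ q X (Y \ Z) := by
  induction Z using Finset.induction_on with
  | empty => simp
  | insert k Z hk ih =>
    have h1 := ih fun k' hk' => hZ k' (Finset.mem_insert_of_mem hk')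
    have h2 := hZ k (Finset.mem_insert_self _ _)
    have h3 := hq.sup X X (Y \ Z) (Y.erase k) (by simpa using hX) (by linarith) (by linarith)
    rw [Finset.union_self, Finset.inter_self] at h3
    have h4 := hq.mono X (Y \ Z ∪ Y.erase k) Y
      (Finset.union_subset Finset.sdiff_subset (Finset.erase_subset _ _))
    rw [show Y \ Z ∩ Y.erase k = Y \ insert k Z by ext; simp; tauto] at h3
    linarith

/-- The demand that remains after an edge from `k` to `t` has been chosen. -/
def residual (q : Finset T → Finset K → ℤ) (t : T) (k : K) (X : Finset T) (Y : Finset K) : ℤ :=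
  if t ∈ X ∧ k ∈ Y then max (q X Y - 1) (q X (Y.erase k)) else q X Y

theorem residual_le (hq : IsDemand q) (t : T) (k : K) (X : Finset T) (Y : Finset K) :
    residual q t k X Y ≤ q X Y := by
  unfold residual
  split_ifs
  · exact max_le (by linarith) (hq.mono X _ _ (Finset.erase_subset _ _))
  · exact le_rfl

theorem le_residual_add (hq : IsDemand q) (t : T) (k : K) (X : Finset T) {Y Y' : Finset K}
    (h : Y ⊆ Y') : q X Y - (if t ∈ X ∧ k ∈ Y then 1 else 0) ≤ residual q t k X Y' := by
  unfold residual
  have h1 := hq.mono X _ _ h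
  split_ifs with h2 h3 h3
  · exact le_max_of_le_left (by linarith)
  · exact absurd ⟨h2.1, h h2.2⟩ h3
  · refine le_max_of_le_right ?_
    have := hq.mono X Y (Y'.erase k) fun y hy =>
      Finset.mem_erase.2 ⟨fun e => h2 ⟨h3.1, e ▸ hy⟩, h hy⟩
    linarith
  · linarith

/-- Together with `le_residual_add`, this identifies the residual as the monotone closure in `Y` of
the demand minus the indicator of the chosen edge. Inequalities for it reduce to inequalities for
`q` and for the indicator. -/
theorem residual_eq (q : Finset T → Finset K → ℤ) (t : T) (k : K) (X : Finset T) (Y : Finset K) :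
    ∃ Y₀ ⊆ Y, residual q t k X Y = q X Y₀ - (if t ∈ X ∧ k ∈ Y₀ then 1 else 0) := by
  unfold residual
  by_cases h : t ∈ X ∧ k ∈ Y
  · rw [if_pos h]
    rcases max_choice (q X Y - 1) (q X (Y.erase k)) with h' | h' <;> rw [h']
    · exact ⟨Y, subset_rfl, by rw [if_pos h]⟩
    · exact ⟨Y.erase k, Finset.erase_subset _ _, by simp⟩
  · exact ⟨Y, subset_rfl, by simp [h]⟩

theorem IsDemand.residual (hq : IsDemand q) (t : T) (k : K) : IsDemand (residual q t k) := by
  constructor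
  · intro X Y Y' h
    obtain ⟨Y₀, hY₀, e⟩ := residual_eq q t k X Y
    rw [e]
    exact le_residual_add hq t k X (hY₀.trans h)
  · intro X X' Y Y' hne hpos hpos'
    obtain ⟨Y₀, hY₀, e⟩ := residual_eq q t k X Y
    obtain ⟨Y₁, hY₁, e'⟩ := residual_eq q t k X' Y'
    have d : ∀ p : Prop, ∀ [Decidable p], (0 : ℤ) ≤ if p then 1 else 0 := by
      intro p _; split_ifs <;> norm_num
    have h1 := hq.sup X X' Y₀ Y₁ hne (by have := d (t ∈ X ∧ k ∈ Y₀); linarith)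
      (by have := d (t ∈ X' ∧ k ∈ Y₁); linarith)
    have h2 := le_residual_add hq t k (X ∪ X') (Finset.inter_subset_inter hY₀ hY₁)
    have h3 := le_residual_add hq t k (X ∩ X') (Finset.union_subset_union hY₀ hY₁)
    have h4 : ((if t ∈ X ∪ X' ∧ k ∈ Y₀ ∩ Y₁ then 1 else 0) +
        (if t ∈ X ∩ X' ∧ k ∈ Y₀ ∪ Y₁ then 1 else 0) : ℤ) ≤
        (if t ∈ X ∧ k ∈ Y₀ then 1 else 0) + (if t ∈ X' ∧ k ∈ Y₁ then 1 else 0) := by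
      simp only [Finset.mem_union, Finset.mem_inter]
      by_cases a : t ∈ X <;> by_cases a' : t ∈ X' <;> by_cases b : k ∈ Y₀ <;>
        by_cases b' : k ∈ Y₁ <;> simp [a, a', b, b']
    linarith

/-- An edge can be chosen so that the remaining demand still fits. -/
theorem exists_fits_residual (hq : IsDemand q) (hm : Fits q c m) {t : T}
    (ht : 0 < q {t} Finset.univ)
    (hfull : ∑ i, (m i : ℤ) ≤ ∑ t, q {t} Finset.univ) :
    ∃ k, 0 < m (c k) ∧ Fits (residual q t k) c (Function.update m (c k) (m (c k) - 1)) := by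
  classical
  have huniv : pre c (Finset.univ : Finset I) = Finset.univ := by ext; simp
  -- the largest tight set avoiding `t`
  have hempty : TightAvoiding q c m t ∅ := ⟨∅, ⟨isFam_empty, by simp, by simp [tot]⟩, by simp [cov]⟩
  obtain ⟨A₀, hA₀, hA₀max⟩ : ∃ A₀, TightAvoiding q c m t A₀ ∧
      ∀ A, TightAvoiding q c m t A → A ⊆ A₀ := by
    obtain ⟨A₀, hA₀⟩ := (Set.toFinite {A | TightAvoiding q c m t A}).exists_maximal ⟨∅, hempty⟩
    exact ⟨A₀, hA₀.prop, fun A hA => Finset.subset_union_left.trans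
      (hA₀.2 (TightAvoiding.union hq hm hA hA₀.prop) Finset.subset_union_right)⟩
  obtain ⟨F₀, hF₀, htF₀⟩ := hA₀
  -- the smallest larger tight set
  let Cov : Finset I → Finset T → Prop := fun A X => ∃ F, Tight q c m A F ∧ X ∈ F ∧ t ∈ X
  -- The whole index set is a candidate: by `hfull` the singletons are tight there. It is not `A₀`,
  -- since adding `{t}` to `F₀` would exceed the allowance.
  have hcovuniv : A₀ ⊂ Finset.univ ∧ ∃ X, Cov Finset.univ X := by
    constructor
    · refine (Finset.subset_univ _).ssubset_of_ne ?_
      rintro rfl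
      have hd : Disjoint {t} (cov F₀) := Finset.disjoint_singleton_left.2 htF₀
      have h1 := hm Finset.univ _ (hF₀.fam.insert (Finset.singleton_nonempty t) hd)
      rw [tot_insert q _ (notMem_of_disjoint_cov (Finset.singleton_nonempty t) hd)] at h1
      have h2 := hF₀.le
      rw [huniv] at h1 h2
      linarith
    · have hfam : IsFam (Finset.univ.image fun t : T => ({t} : Finset T)) := by
        constructor
        · simp
        · intro X hX X' hX' hne
          simp only [Finset.mem_image, Finset.mem_univ, true_and] at hX hX'
          obtain ⟨u, rfl⟩ := hX
          obtain ⟨v, rfl⟩ := hX'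
          rw [Finset.disjoint_singleton]
          rintro rfl
          exact hne rfl
      refine ⟨{t}, _, Tight.of_le hfam ?_, ?_, Finset.mem_singleton_self t⟩
      · rw [huniv, tot, Finset.sum_image fun a _ b _ h => Finset.singleton_injective h]
        exact hfull
      · rw [huniv]
        exact Finset.mem_filter.2 ⟨Finset.mem_image_of_mem _ (Finset.mem_univ t), ht⟩
  obtain ⟨A₁, hA₁⟩ := (Set.toFinite {A | A₀ ⊂ A ∧ ∃ X, Cov A X}).exists_minimal ⟨_, hcovuniv⟩
  obtain ⟨h01, hX⟩ := hA₁.prop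
  -- Maximality of `X₁` will force any uncrossed partner containing `t` to lie inside it.
  obtain ⟨X₁, hX₁, hX₁max⟩ := Finset.exists_max_image (Finset.univ.filter fun X => Cov A₁ X)
    Finset.card (by obtain ⟨X, hX⟩ := hX; exact ⟨X, by simpa using hX⟩)
  simp only [Finset.mem_filter, Finset.mem_univ, true_and] at hX₁ hX₁max
  obtain ⟨F₁, hF₁, hXF₁, htX₁⟩ := hX₁
  have hpos₁ := hF₁.pos X₁ hXF₁
  have hnotin : ∀ {A F X}, Tight q c m A F → X ∈ F → t ∈ X → ¬ A ⊆ A₀ →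
      Disjoint X (cov F₀) := by
    intro A F X hF hX htX hA
    by_contra hd
    exact hA (Finset.subset_union_left.trans
      (hA₀max _ (hF.union_tightAvoiding hq hm hF₀ hX htX htF₀ hd)))
  have hd₁ := hnotin hF₁ hXF₁ htX₁ h01.2
  -- The other end of the new edge is a vertex of a class in `A₁ \ A₀` with spare allowance, without
  -- which the demand of `X₁` drops. If there were none, `X₁` would keep its positive demand down to
  -- `pre c A₀`, and adding it to `F₀` would violate `hm`.
  obtain ⟨k, hk₁, hk₀, hmk, hqk⟩ : ∃ k, c k ∈ A₁ ∧ c k ∉ A₀ ∧ 0 < m (c k) ∧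
      q X₁ ((pre c A₁).erase k) < q X₁ (pre c A₁) := by
    by_contra hno
    push Not at hno
    have h1 := hq.le_sdiff ⟨t, htX₁⟩ hpos₁
      (Finset.univ.filter fun k => c k ∈ A₁ ∧ c k ∉ A₀ ∧ 0 < m (c k))
      (fun k hk => by
        simp only [Finset.mem_filter, Finset.mem_univ, true_and] at hk
        exact hno k hk.1 hk.2.1 hk.2.2)
    -- Classes of zero allowance can be added for free, so maximality of `A₀` shows that it already
    -- contains those in `A₁`.
    set A₂ := A₀ ∪ A₁.filter fun i => m i = 0
    have h2 : ∑ i ∈ A₂, (m i : ℤ) = ∑ i ∈ A₀, (m i : ℤ) := by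
      symm
      refine Finset.sum_subset Finset.subset_union_left fun i hi hi' => ?_
      simp only [A₂, Finset.mem_union, hi', false_or, Finset.mem_filter] at hi
      simp [hi.2]
    have h3 : A₂ ⊆ A₀ := hA₀max _ (TightAvoiding.of_le hF₀.fam
      (by rw [h2]; exact hF₀.le.trans (hq.tot_mono F₀ (pre_mono c Finset.subset_union_left)))
      htF₀)
    have h4 := hq.mono X₁ (pre c A₁ \ Finset.univ.filter
        fun k => c k ∈ A₁ ∧ c k ∉ A₀ ∧ 0 < m (c k)) (pre c A₀) (by
      intro k hk
      simp only [Finset.mem_sdiff, mem_pre, Finset.mem_filter, Finset.mem_univ, true_and,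
        not_and, not_lt, Nat.le_zero] at hk
      rw [mem_pre]
      by_contra hk0
      exact hk0 (h3 (Finset.mem_union_right _ (Finset.mem_filter.2 ⟨hk.1, hk.2 hk.1 hk0⟩))))
    have h5 := hm A₀ _ (hF₀.fam.insert ⟨t, htX₁⟩ hd₁)
    rw [tot_insert q _ (notMem_of_disjoint_cov ⟨t, htX₁⟩ hd₁)] at h5
    have h6 := hF₀.le
    linarith
  refine ⟨k, hmk, fun A F hF => ?_⟩
  by_cases hkA : c k ∈ A
  swap
  · have h1 : ∑ i ∈ A, ((Function.update m (c k) (m (c k) - 1) i : ℕ) : ℤ) = ∑ i ∈ A, (m i : ℤ) := by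
      refine Finset.sum_congr rfl fun i hi => ?_
      rw [Function.update_of_ne]
      rintro rfl
      exact hkA hi
    rw [h1]
    exact (Finset.sum_le_sum fun X _ => residual_le hq t k X _).trans (hm A F hF)
  have hsum : ∑ i ∈ A, ((Function.update m (c k) (m (c k) - 1) i : ℕ) : ℤ)
      = ∑ i ∈ A, (m i : ℤ) - 1 := by
    rw [← Finset.add_sum_erase _ _ hkA, ← Finset.add_sum_erase A (fun i => (m i : ℤ)) hkA,
      Function.update_self]
    have : ∑ i ∈ A.erase (c k), ((Function.update m (c k) (m (c k) - 1) i : ℕ) : ℤ)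
        = ∑ i ∈ A.erase (c k), (m i : ℤ) :=
      Finset.sum_congr rfl fun i hi => by rw [Function.update_of_ne (Finset.ne_of_mem_erase hi)]
    rw [this]
    push_cast [Nat.cast_sub (show 1 ≤ m (c k) from hmk)]
    ring
  rw [hsum]
  -- A violation after the loss of one unit means that `F` was tight before and that the new edge
  -- lowers the demand of none of its members.
  by_contra hlt
  have hle : ∀ X ∈ F, residual q t k X (pre c A) ≤ q X (pre c A) :=
    fun X _ => residual_le hq t k X _
  have h1 : tot q F (pre c A) ≤ tot (residual q t k) F (pre c A) := by
    have := hm A F hF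
    linarith
  have heq : ∀ X ∈ F, residual q t k X (pre c A) = q X (pre c A) :=
    (Finset.sum_eq_sum_iff_of_le hle).1 (le_antisymm (Finset.sum_le_sum hle) h1)
  have hkpre : k ∈ pre c A := mem_pre.2 hkA
  have hnA : ¬ A ⊆ A₀ := fun h => hk₀ (h hkA)
  have hF' : Tight q c m A (F.filter fun X => 0 < q X (pre c A)) :=
    Tight.of_le hF ((by linarith : _ ≤ tot (residual q t k) F (pre c A)).trans
      (Finset.sum_le_sum hle))
  by_cases htF : t ∈ cov (F.filter fun X => 0 < q X (pre c A))
  swap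
  · exact hnA (hA₀max A ⟨_, hF', htF⟩)
  obtain ⟨X, hXF, htX⟩ := mem_cov.1 htF
  have hXq : q X (pre c A) ≤ q X ((pre c A).erase k) := by
    have := heq X (Finset.mem_filter.1 hXF).1
    rw [residual, if_pos ⟨htX, hkpre⟩] at this
    rcases max_choice (q X (pre c A) - 1) (q X ((pre c A).erase k)) with h | h <;> linarith
  obtain ⟨⟨N, hN, hXN⟩, hXle⟩ := hF'.union_of_disjoint hq hm hF₀ hXF
    (hnotin hF' hXF htX hnA)
  have hmeet : c k ∈ A₁ ∩ (A ∪ A₀) :=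
    Finset.mem_inter.2 ⟨hk₁, Finset.mem_union_left _ hkA⟩
  rcases hF₁.inter hq hm hN hXF₁ hXN htX₁ htX with h | ⟨M, C, hM, hCM, hC⟩
  · exact hk₀ (hA₀max _ h hmeet)
  have hC₁ : Cov (A₁ ∩ (A ∪ A₀)) C := ⟨M, hM, hCM, hC (Finset.mem_union_left _ htX₁)⟩
  have hsub : A₁ ⊆ A₁ ∩ (A ∪ A₀) :=
    hA₁.2 ⟨⟨Finset.subset_inter h01.1 Finset.subset_union_right, fun h => hk₀ (h hmeet)⟩, C, hC₁⟩
      Finset.inter_subset_left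
  have hA₁eq : A₁ ∩ (A ∪ A₀) = A₁ := Finset.inter_subset_left.antisymm hsub
  rw [hA₁eq] at hC₁
  have hCX : X₁ = C :=
    Finset.eq_of_subset_of_card_le (Finset.subset_union_left.trans hC) (hX₁max C hC₁)
  have hXX₁ : X ⊆ X₁ := by
    rw [hCX]
    exact Finset.subset_union_right.trans hC
  have hsubpre : pre c A₁ ⊆ pre c (A ∪ A₀) := pre_mono c (hsub.trans Finset.inter_subset_right)
  have h2 := hq.mono X _ _ (Finset.erase_subset_erase k
    (pre_mono c (Finset.subset_union_left (s₁ := A) (s₂ := A₀))))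
  have h3 := hN.pos X hXN
  -- The demand of `X` at `A ∪ A₀` does not drop when `k` is removed. Uncrossing with `X₁ ⊇ X`
  -- transfers this to `X₁` at `A₁`, contrary to the choice of `k`.
  have h4 := hq.sup X₁ X (pre c A₁) ((pre c (A ∪ A₀)).erase k)
    ⟨t, Finset.mem_inter.2 ⟨htX₁, htX⟩⟩ hpos₁ (by linarith)
  rw [Finset.union_eq_left.2 hXX₁, Finset.inter_eq_right.2 hXX₁,
    show pre c A₁ ∩ (pre c (A ∪ A₀)).erase k = (pre c A₁).erase k by
      rw [Finset.inter_comm, Finset.erase_inter, Finset.inter_eq_right.2 hsubpre]] at h4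
  have h5 := hq.mono X (pre c A₁ ∪ (pre c (A ∪ A₀)).erase k) (pre c (A ∪ A₀))
    (Finset.union_subset hsubpre (Finset.erase_subset _ _))
  linarith

/-- A demand function that fits `m`, and whose singletons use up all of `m`, is covered by a
bipartite multigraph with at most `m i` edges at the `i`-th class. -/
theorem exists_cover (n : ℕ) : ∀ (q : Finset T → Finset K → ℤ) (m : I → ℕ), ∑ i, m i = n →
    IsDemand q → Fits q c m → ∑ i, (m i : ℤ) ≤ ∑ t, q {t} Finset.univ →
    ∃ x : T → K → ℕ, (∀ X Y, X.Nonempty → q X Y ≤ ∑ t ∈ X, ∑ k ∈ Y, (x t k : ℤ)) ∧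
      ∀ i, ∑ t, ∑ k with c k = i, x t k ≤ m i := by
  induction n with
  | zero =>
    intro q m hn hq hm _
    refine ⟨fun _ _ => 0, fun X Y hX => ?_, by simp⟩
    have h1 := hm Finset.univ {X} (by
      refine ⟨by simpa using hX, fun A hA B hB hne => ?_⟩
      rw [Finset.mem_singleton] at hA hB
      exact absurd (hA.trans hB.symm) hne)
    have h2 := hq.mono X Y (pre c Finset.univ) (fun k _ => by simp)
    have h3 : ∑ i, (m i : ℤ) = 0 := by exact_mod_cast hn
    rw [h3, tot, Finset.sum_singleton] at h1
    simpa using h2.trans h1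
  | succ n ih =>
    intro q m hn hq hm hfull
    have hn' : ∑ i, (m i : ℤ) = n + 1 := by exact_mod_cast hn
    obtain ⟨t, -, ht⟩ : ∃ t ∈ Finset.univ, 0 < q {t} Finset.univ := by
      by_contra hno
      push Not at hno
      have := Finset.sum_nonpos hno
      linarith
    obtain ⟨k, hmk, hfit⟩ := exists_fits_residual hq hm ht hfull
    have hsum : ∑ i, Function.update m (c k) (m (c k) - 1) i = n := by
      have h1 := Finset.sum_update_of_mem (Finset.mem_univ (c k)) m (m (c k) - 1)
      have h2 := Finset.add_sum_erase Finset.univ m (Finset.mem_univ (c k))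
      rw [← Finset.erase_eq] at h1
      omega
    obtain ⟨x, hx, hxm⟩ := ih _ _ hsum (hq.residual t k) hfit (by
      have h1 : ∑ u, (q {u} Finset.univ - if u = t then 1 else 0)
          ≤ ∑ u, residual q t k {u} Finset.univ := by
        refine Finset.sum_le_sum fun u _ => ?_
        have := le_residual_add hq t k {u} (subset_refl (Finset.univ : Finset K))
        simpa [eq_comm] using this
      rw [Finset.sum_sub_distrib, Finset.sum_ite_eq' Finset.univ t, if_pos (Finset.mem_univ t)]
        at h1
      have h2 : ∑ i, ((Function.update m (c k) (m (c k) - 1) i : ℕ) : ℤ) = n := by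
        exact_mod_cast hsum
      rw [h2]
      linarith)
    refine ⟨fun u j => x u j + if u = t ∧ j = k then 1 else 0, fun X Y hX => ?_, fun i => ?_⟩
    · have h1 := hx X Y hX
      have h2 := le_residual_add hq t k X (subset_refl Y)
      have h3 : ∑ u ∈ X, ∑ j ∈ Y, ((x u j + if u = t ∧ j = k then 1 else 0 : ℕ) : ℤ)
          = ∑ u ∈ X, ∑ j ∈ Y, (x u j : ℤ) + if t ∈ X ∧ k ∈ Y then 1 else 0 := by
        push_cast
        simp_rw [Finset.sum_add_distrib]
        congr 1
        simp_rw [ite_and, Finset.sum_ite_irrel, Finset.sum_const_zero, Finset.sum_ite_eq']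
      rw [h3]
      linarith
    · have h1 := hxm i
      have h3 : ∑ u, ∑ j with c j = i, (x u j + if u = t ∧ j = k then 1 else 0)
          = ∑ u, ∑ j with c j = i, x u j + if c k = i then 1 else 0 := by
        simp_rw [Finset.sum_add_distrib]
        congr 1
        simp_rw [ite_and, Finset.sum_ite_irrel, Finset.sum_const_zero, Finset.sum_ite_eq']
        simp
      rw [h3]
      by_cases hi : c k = i
      · subst hi
        rw [Function.update_self] at h1
        rw [if_pos rfl]
        omega
      · rw [Function.update_of_ne (Ne.symm hi)] at h1
        simpa [hi] using h1

end Covering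

/-! ### From lower and upper class bounds to exact class degrees. -/

section Linking

variable {T K J : Type*} [Fintype T] [DecidableEq T] [Fintype K] [DecidableEq K] [Fintype J]
  [DecidableEq J]

/-- The bound on the demand at `A` when the `j`-th class receives between `f₁ j` and `f₂ j` edges,
the class `none` receives the rest, and there are `G` edges. -/
def border (G : ℕ) (f₁ f₂ : J → ℕ) (A : Finset (Option J)) : ℤ :=
  if none ∈ A then (G : ℤ) - ∑ j with some j ∉ A, (f₁ j : ℤ) else ∑ j with some j ∈ A, (f₂ j : ℤ)

/-- The gap is the sum of `f₂ i - f₁ i` over the classes `i` in `A'` but not in `A`, and `j` makes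
it positive. -/
theorem border_inter_add_border_union_lt (G : ℕ) {f₁ f₂ : J → ℕ} (hf : ∀ j, f₁ j ≤ f₂ j)
    {A A' : Finset (Option J)} (hA : none ∈ A) (hA' : none ∉ A') {j : J} (hj : some j ∉ A)
    (hj' : some j ∈ A') (hlt : f₁ j < f₂ j) :
    border G f₁ f₂ (A ∩ A') + border G f₁ f₂ (A ∪ A') < border G f₁ f₂ A + border G f₁ f₂ A' := by
  have h : ∑ i, ((if some i ∈ A ∩ A' then (f₂ i : ℤ) else 0) + if some i ∉ A then (f₁ i : ℤ) else 0)
      < ∑ i, ((if some i ∈ A' then (f₂ i : ℤ) else 0)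
        + if some i ∉ A ∪ A' then (f₁ i : ℤ) else 0) := by
    refine Finset.sum_lt_sum (fun i _ => ?_) ⟨j, Finset.mem_univ j, ?_⟩
    · have : (f₁ i : ℤ) ≤ f₂ i := by exact_mod_cast hf i
      by_cases a : some i ∈ A <;> by_cases a' : some i ∈ A' <;> simp [a, a', this]
    · simpa [hj, hj'] using hlt
  simp only [Finset.sum_add_distrib, ← Finset.sum_filter] at h
  simp only [border, Finset.mem_inter, Finset.mem_union, hA, hA', and_false, true_or, if_true,
    if_false] at h ⊢
  linarith

theorem sum_update_eq {s : Finset J} (f : J → ℕ) {j : J} (hj : j ∉ s) (a : ℕ) :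
    ∑ i ∈ s, ((Function.update f j a i : ℕ) : ℤ) = ∑ i ∈ s, (f i : ℤ) :=
  Finset.sum_congr rfl fun i hi => by
    rw [Function.update_of_ne]
    rintro rfl
    exact hj hi

theorem sum_update_add {s : Finset J} (f : J → ℕ) {j : J} (hj : j ∈ s) (a : ℕ) :
    ∑ i ∈ s, ((Function.update f j a i : ℕ) : ℤ) + f j = ∑ i ∈ s, (f i : ℤ) + a := by
  rw [← Finset.add_sum_erase _ _ hj, ← Finset.add_sum_erase s (fun i => (f i : ℤ)) hj,
    Function.update_self, sum_update_eq f (Finset.notMem_erase j s)]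
  ring

/-- Lower and upper bounds on the classes can be replaced by exact prescriptions. -/
theorem exists_exact {q : Finset T → Finset K → ℤ} (hq : IsDemand q) (c : K → Option J) (G n : ℕ) :
    ∀ f₁ f₂ : J → ℕ, ∑ j, f₂ j = ∑ j, f₁ j + n → (∀ j, f₁ j ≤ f₂ j) →
      (∀ A F, IsFam F → tot q F (pre c A) ≤ border G f₁ f₂ A) →
      ∃ f : J → ℕ, (∀ j, f₁ j ≤ f j ∧ f j ≤ f₂ j) ∧
        ∀ A F, IsFam F → tot q F (pre c A) ≤ border G f f A := by
  induction n with
  | zero =>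
    intro f₁ f₂ hn hf h
    have : f₁ = f₂ := funext fun j =>
      (Finset.sum_eq_sum_iff_of_le fun i _ => hf i).1 hn.symm j (Finset.mem_univ j)
    subst this
    exact ⟨f₁, fun j => ⟨le_rfl, le_rfl⟩, h⟩
  | succ n ih =>
    intro f₁ f₂ hn hf h
    obtain ⟨j, -, hj⟩ : ∃ j ∈ Finset.univ, f₁ j < f₂ j := by
      by_contra hno
      push Not at hno
      have := Finset.sum_le_sum hno
      omega
    by_cases h1 : ∀ A F, IsFam F →
        tot q F (pre c A) ≤ border G (Function.update f₁ j (f₁ j + 1)) f₂ A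
    · have e := sum_update_add f₁ (Finset.mem_univ j) (f₁ j + 1)
      obtain ⟨f, hff, hfit⟩ := ih _ f₂ (by zify at hn ⊢; push_cast at e; linarith)
        (fun i => by
          by_cases hi : i = j
          · subst hi
            rw [Function.update_self]
            exact hj
          · rw [Function.update_of_ne hi]
            exact hf i) h1
      refine ⟨f, fun i => ⟨?_, (hff i).2⟩, hfit⟩
      have := (hff i).1
      by_cases hi : i = j
      · subst hi
        rw [Function.update_self] at this
        omega
      · rwa [Function.update_of_ne hi] at this
    by_cases h2 : ∀ A F, IsFam F →
        tot q F (pre c A) ≤ border G f₁ (Function.update f₂ j (f₂ j - 1)) A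
    · have e := sum_update_add f₂ (Finset.mem_univ j) (f₂ j - 1)
      push_cast [Nat.cast_sub (show 1 ≤ f₂ j by omega)] at e
      obtain ⟨f, hff, hfit⟩ := ih f₁ _ (by zify at hn ⊢; linarith)
        (fun i => by
          by_cases hi : i = j
          · subst hi
            rw [Function.update_self]
            omega
          · rw [Function.update_of_ne hi]
            exact hf i) h2
      refine ⟨f, fun i => ⟨(hff i).1, ?_⟩, hfit⟩
      have := (hff i).2
      by_cases hi : i = j
      · subst hi
        rw [Function.update_self] at this
        omega
      · rwa [Function.update_of_ne hi] at this
    -- If neither raising `f₁ j` nor lowering `f₂ j` is possible, both obstructing families attain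
    -- the current bounds, and uncrossing them contradicts the strict inequality for `border`.
    exfalso
    push Not at h1 h2
    obtain ⟨A, F, hF, hlt⟩ := h1
    obtain ⟨A', F', hF', hlt'⟩ := h2
    have hle := h A F hF
    have hle' := h A' F' hF'
    -- Only then does `border` at `A` involve `f₁ j`; otherwise raising it could not have created a
    -- violation. The case of `A'` and `f₂ j` is analogous.
    have hA : none ∈ A ∧ some j ∉ A ∧
        border G f₁ f₂ A ≤ border G (Function.update f₁ j (f₁ j + 1)) f₂ A + 1 := by
      have hn : none ∈ A := by
        by_contra hn
        simp only [border, if_neg hn] at hlt hle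
        linarith
      have hjA : some j ∉ A := by
        intro hjA
        simp only [border, if_pos hn] at hlt hle
        rw [sum_update_eq f₁ (by simp [hjA])] at hlt
        linarith
      refine ⟨hn, hjA, ?_⟩
      simp only [border, if_pos hn]
      have := sum_update_add f₁ (s := Finset.univ.filter fun i => some i ∉ A) (j := j)
        (by simp [hjA]) (f₁ j + 1)
      push_cast at this
      linarith
    have hA' : none ∉ A' ∧ some j ∈ A' ∧
        border G f₁ f₂ A' ≤ border G f₁ (Function.update f₂ j (f₂ j - 1)) A' + 1 := by
      have hn : none ∉ A' := by
        intro hn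
        simp only [border, if_pos hn] at hlt' hle'
        linarith
      have hjA : some j ∈ A' := by
        by_contra hjA
        simp only [border, if_neg hn] at hlt' hle'
        rw [sum_update_eq f₂ (by simp [hjA])] at hlt'
        linarith
      refine ⟨hn, hjA, ?_⟩
      simp only [border, if_neg hn]
      have := sum_update_add f₂ (s := Finset.univ.filter fun i => some i ∈ A') (j := j)
        (by simp [hjA]) (f₂ j - 1)
      push_cast [Nat.cast_sub (show 1 ≤ f₂ j by omega)] at this
      linarith
    obtain ⟨M, N, hM, hN, -, -, hMN⟩ := (hq.uncrosses
      (Y := pre c A) (Y' := pre c A') (hF.subset (Finset.filter_subset _ _))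
      (hF'.subset (Finset.filter_subset _ _))
      (fun X hX => (Finset.mem_filter.1 hX).2) (fun X hX => (Finset.mem_filter.1 hX).2)).1
    rw [← pre_inter, ← pre_union] at hMN
    have e1 := h (A ∩ A') M hM
    have e2 := h (A ∪ A') N hN
    have e3 := tot_le_tot_filter_pos q F (pre c A)
    have e4 := tot_le_tot_filter_pos q F' (pre c A')
    have e5 := border_inter_add_border_union_lt G hf hA.1 hA'.1 hA.2.1 hA'.2.1 hj
    linarith [hA.2.2, hA'.2.2]

/-- With equal bounds `border` becomes modular: the class `none` gets the weight `G - ∑ j, f j`, as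
required by `Fits`. -/
theorem border_self_eq_sum {G : ℕ} {f : J → ℕ} (h : ∑ j, f j ≤ G) (A : Finset (Option J)) :
    border G f f A = ∑ i ∈ A, ((Option.elim i (G - ∑ j, f j) f : ℕ) : ℤ) := by
  have h1 : ∀ A : Finset (Option J), none ∉ A →
      ∑ i ∈ A, ((Option.elim i (G - ∑ j, f j) f : ℕ) : ℤ) = ∑ j with some j ∈ A, (f j : ℤ) := by
    intro A hA
    have : A = (Finset.univ.filter fun j => some j ∈ A).map Function.Embedding.some := by
      ext i
      cases i with
      | none => simp [hA]
      | some j => simp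
    conv_lhs => rw [this]
    rw [Finset.sum_map]
    simp
  by_cases hA : none ∈ A
  · rw [border, if_pos hA, ← Finset.add_sum_erase _ _ hA, h1 _ (Finset.notMem_erase _ _)]
    have h2 := Finset.sum_filter_add_sum_filter_not Finset.univ (fun j => some j ∈ A)
      (fun j => (f j : ℤ))
    simp only [Finset.mem_erase, ne_eq, reduceCtorEq, not_false_eq_true, true_and,
      Option.elim_none]
    push_cast [Nat.cast_sub h]
    linarith
  · rw [border, if_neg hA, h1 A hA]

end Linking

/-! ### Cardinality and matroid rank treated alike. -/

section Rank

variable {S : Type*} [Fintype S] [DecidableEq S]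

/-- The properties of matroid rank functions that matter for covering. -/
structure IsRankLike (ρ : Finset S → ℕ) : Prop where
  mono : ∀ A B, A ⊆ B → ρ A ≤ ρ B
  submod : ∀ A B, ρ (A ∪ B) + ρ (A ∩ B) ≤ ρ A + ρ B
  le_card : ∀ A, ρ A ≤ A.card

theorem isRankLike_card : IsRankLike (Finset.card : Finset S → ℕ) :=
  ⟨fun _ _ => Finset.card_le_card, fun A B => (Finset.card_union_add_card_inter A B).le,
    fun _ => le_rfl⟩

theorem coe_rank (M : Matroid S) (A : Finset S) : (rank M A : ℕ∞) = M.eRk (A : Set S) := by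
  rw [rank, ENat.natCast_toNat]
  refine ne_top_of_le_ne_top ?_ (M.eRk_le_encard _)
  simp

theorem isRankLike_rank (M : Matroid S) : IsRankLike (rank M) := by
  refine ⟨fun A B h => ?_, fun A B => ?_, fun A => ?_⟩
  · rw [← Nat.cast_le (α := ℕ∞), coe_rank, coe_rank]
    exact M.eRk_mono (by exact_mod_cast h)
  · rw [← Nat.cast_le (α := ℕ∞)]
    push_cast
    rw [coe_rank, coe_rank, coe_rank, coe_rank, add_comm]
    push_cast
    exact M.eRk_inter_add_eRk_union_le _ _
  · rw [← Nat.cast_le (α := ℕ∞), coe_rank]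
    exact (M.eRk_le_encard _).trans (by simp)

theorem IsRankLike.union_le {ρ : Finset S → ℕ} (hρ : IsRankLike ρ) (A B : Finset S) :
    ρ (A ∪ B) ≤ ρ A + (B \ A).card := by
  have h1 := hρ.submod A (B \ A)
  have h2 := hρ.le_card (B \ A)
  rw [Finset.union_sdiff_self_eq_union] at h1
  omega

end Rank

/-! ### Counting edges, and necessity of the two inequalities. -/

section Bipartite

variable {S T : Type*} [Fintype S] [DecidableEq S] [Fintype T] [DecidableEq T]

theorem mem_nbr {E : Finset (S × T)} {X : Finset T} {s : S} :
    s ∈ nbr E X ↔ ∃ t ∈ X, (s, t) ∈ E := by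
  simp [nbr]

theorem nbr_union_left (E E' : Finset (S × T)) (X : Finset T) :
    nbr (E ∪ E') X = nbr E X ∪ nbr E' X := by
  ext s
  simp only [mem_nbr, Finset.mem_union]
  grind

theorem nbr_union_right (E : Finset (S × T)) (X X' : Finset T) :
    nbr E (X ∪ X') = nbr E X ∪ nbr E X' := by
  ext s
  simp only [mem_nbr, Finset.mem_union]
  grind

theorem nbr_mono (E : Finset (S × T)) {X X' : Finset T} (h : X ⊆ X') : nbr E X ⊆ nbr E X' := by
  intro s hs
  obtain ⟨t, ht, hst⟩ := mem_nbr.1 hs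
  exact mem_nbr.2 ⟨t, h ht, hst⟩

theorem degS_eq (E : Finset (S × T)) (s : S) : degS E s = ∑ t, if (s, t) ∈ E then 1 else 0 := by
  rw [← Finset.card_filter, degS]
  symm
  refine Finset.card_bij (fun t _ => (s, t)) ?_ ?_ ?_
  · intro t ht
    simpa using ht
  · intro t _ t' _ h
    exact (Prod.ext_iff.1 h).2
  · rintro ⟨s', t⟩ h
    rw [Finset.mem_filter] at h
    obtain ⟨h, rfl⟩ := h
    exact ⟨t, by simpa using h, rfl⟩

theorem degT_eq (E : Finset (S × T)) (t : T) : degT E t = ∑ s, if (s, t) ∈ E then 1 else 0 := by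
  rw [← Finset.card_filter, degT]
  symm
  refine Finset.card_bij (fun s _ => (s, t)) ?_ ?_ ?_
  · intro s hs
    simpa using hs
  · intro s _ s' _ h
    exact (Prod.ext_iff.1 h).1
  · rintro ⟨s, t'⟩ h
    rw [Finset.mem_filter] at h
    obtain ⟨h, rfl⟩ := h
    exact ⟨s, by simpa using h, rfl⟩

/-- The number of edges between `X ⊆ T` and `Z ⊆ S`. -/
def edgesBetween (E : Finset (S × T)) (X : Finset T) (Z : Finset S) : ℕ :=
  ∑ t ∈ X, ∑ s ∈ Z, if (s, t) ∈ E then 1 else 0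

theorem edgesBetween_univ_left (E : Finset (S × T)) (Z : Finset S) :
    edgesBetween E Finset.univ Z = ∑ s ∈ Z, degS E s := by
  simp_rw [degS_eq]
  exact Finset.sum_comm

theorem edgesBetween_univ_right (E : Finset (S × T)) (X : Finset T) :
    edgesBetween E X Finset.univ = ∑ t ∈ X, degT E t := by
  simp_rw [degT_eq]
  rfl

theorem edgesBetween_add_compl (E : Finset (S × T)) (X : Finset T) (Z : Finset S) :
    edgesBetween E X Z + edgesBetween E X Zᶜ = ∑ t ∈ X, degT E t := by
  rw [← edgesBetween_univ_right, edgesBetween, edgesBetween, edgesBetween, ← Finset.sum_add_distrib]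
  exact Finset.sum_congr rfl fun t _ => Finset.sum_add_sum_compl _ _

theorem edgesBetween_mono (E : Finset (S × T)) {X X' : Finset T} (h : X ⊆ X') (Z : Finset S) :
    edgesBetween E X Z ≤ edgesBetween E X' Z :=
  Finset.sum_le_sum_of_subset h

theorem card_nbr_inter_le (E : Finset (S × T)) (X : Finset T) (Z : Finset S) :
    (nbr E X ∩ Z).card ≤ edgesBetween E X Z := by
  have : nbr E X ∩ Z ⊆ X.biUnion fun t => Z.filter fun s => (s, t) ∈ E := by
    intro s hs
    rw [Finset.mem_inter, mem_nbr] at hs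
    obtain ⟨⟨t, ht, hst⟩, hZ⟩ := hs
    exact Finset.mem_biUnion.2 ⟨t, ht, Finset.mem_filter.2 ⟨hZ, hst⟩⟩
  refine (Finset.card_le_card this).trans (Finset.card_biUnion_le.trans (le_of_eq ?_))
  exact Finset.sum_congr rfl fun t _ => Finset.card_filter _ _

theorem edgesBetween_biUnion (E : Finset (S × T)) {n : ℕ} {X : Fin n → Finset T}
    (hX : IsDisjointFamily X) (Z : Finset S) :
    edgesBetween E (Finset.univ.biUnion X) Z = ∑ j, edgesBetween E (X j) Z :=
  Finset.sum_biUnion fun i _ j _ hij => hX.2 i j hij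

variable {l : ℕ} {P : Fin l → Finset S}

theorem IsPartition.subset_biUnion_iff (hP : IsPartition P) {A : Finset (Fin l)} {α : Fin l} :
    P α ⊆ A.biUnion P ↔ α ∈ A := by
  refine ⟨fun h => ?_, fun h => Finset.subset_biUnion_of_mem P h⟩
  obtain ⟨s, hs⟩ := hP.1 α
  obtain ⟨β, hβ, hsβ⟩ := Finset.mem_biUnion.1 (h hs)
  by_contra hα
  exact Finset.disjoint_left.1 (hP.2.1 α β (by rintro rfl; exact hα hβ)) hs hsβ

theorem IsPartition.subset_compl_biUnion_iff (hP : IsPartition P) {A : Finset (Fin l)}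
    {α : Fin l} : P α ⊆ (A.biUnion P)ᶜ ↔ α ∉ A := by
  constructor
  · intro h hα
    obtain ⟨s, hs⟩ := hP.1 α
    exact Finset.mem_compl.1 (h hs) (Finset.mem_biUnion.2 ⟨α, hα, hs⟩)
  · intro h s hs
    rw [Finset.mem_compl, Finset.mem_biUnion]
    rintro ⟨β, hβ, hsβ⟩
    exact Finset.disjoint_left.1 (hP.2.1 α β (by rintro rfl; exact h hβ)) hs hsβ

theorem IsPartition.sum_biUnion (hP : IsPartition P) (A : Finset (Fin l)) (f : S → ℕ) :
    ∑ s ∈ A.biUnion P, f s = ∑ α ∈ A, ∑ s ∈ P α, f s :=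
  Finset.sum_biUnion fun α _ β _ h => hP.2.1 α β h

theorem IsPartition.compl_biUnion (hP : IsPartition P) (A : Finset (Fin l)) :
    (A.biUnion P)ᶜ = Aᶜ.biUnion P := by
  ext s
  obtain ⟨α, -, hα⟩ := Finset.mem_biUnion.1 (hP.2.2.symm ▸ Finset.mem_univ s)
  have huniq : ∀ β, s ∈ P β → β = α := fun β hβ => by
    by_contra hne
    exact Finset.disjoint_left.1 (hP.2.1 β α hne) hβ hα
  simp only [Finset.mem_compl, Finset.mem_biUnion, not_exists, not_and]
  constructor
  · intro h
    exact ⟨α, fun h' => h α h' hα, hα⟩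
  · rintro ⟨β, hβ, hsβ⟩ γ hγ hsγ
    rw [huniq β hsβ] at hβ
    exact hβ (huniq γ hsγ ▸ hγ)

variable {ρ : Finset S → ℕ} {E₀ E : Finset (S × T)} {p : Finset T → ℤ} {f₁ f₂ : Fin l → ℕ}
  {g : T → ℕ}

/-- The neighbours of `X` missing from `Zᶜ ∪ nbr E₀ X` lie in `Z` and each uses an edge of `E` from
`X`; the rank grows by at most their number. -/
theorem Covers.sub_le_edgesBetween (hρ : IsRankLike ρ) (h : Covers ρ (E ∪ E₀) p) {X : Finset T}
    (hX : X.Nonempty) (Z : Finset S) :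
    p X - (ρ (Zᶜ ∪ nbr E₀ X) : ℤ) ≤ edgesBetween E X Z := by
  have h1 := h X hX
  have h2 := hρ.mono (nbr (E ∪ E₀) X) ((Zᶜ ∪ nbr E₀ X) ∪ nbr E X) (by
    rw [nbr_union_left]
    exact Finset.union_subset Finset.subset_union_right
      (Finset.subset_union_right.trans Finset.subset_union_left))
  have h3 := hρ.union_le (Zᶜ ∪ nbr E₀ X) (nbr E X)
  have h4 : (nbr E X \ (Zᶜ ∪ nbr E₀ X)).card ≤ (nbr E X ∩ Z).card := by
    refine Finset.card_le_card fun s hs => ?_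
    simp only [Finset.mem_sdiff, Finset.mem_union, Finset.mem_compl, not_or, not_not] at hs
    exact Finset.mem_inter.2 ⟨hs.1, hs.2.1⟩
  have h5 := card_nbr_inter_le E X Z
  have h6 : ρ (nbr (E ∪ E₀) X) ≤ ρ (Zᶜ ∪ nbr E₀ X) + edgesBetween E X Z := by omega
  have : (ρ (nbr (E ∪ E₀) X) : ℤ) ≤ ρ (Zᶜ ∪ nbr E₀ X) + edgesBetween E X Z := by
    exact_mod_cast h6
  linarith

theorem IsGoodAugmentation.upperIneq (hρ : IsRankLike ρ) (hP : IsPartition P)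
    (hE : IsGoodAugmentation ρ E₀ p P f₁ f₂ g E) {n : ℕ} {X : Fin n → Finset T} {S₀ : Finset S}
    (hX : IsDisjointFamily X) (hS₀ : IsUnionOfParts P S₀) : UpperIneq ρ E₀ p P f₂ X S₀ := by
  obtain ⟨A, rfl⟩ := hS₀
  unfold UpperIneq
  simp_rw [hP.subset_biUnion_iff]
  have h1 : ∑ j, edgesBetween E (X j) (A.biUnion P) ≤ ∑ α ∈ A, f₂ α := by
    rw [← edgesBetween_biUnion E hX]
    refine (edgesBetween_mono E (Finset.subset_univ _) _).trans ?_
    rw [edgesBetween_univ_left, hP.sum_biUnion]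
    exact Finset.sum_le_sum fun α _ => (hE.2.1 α).2
  calc _ ≤ ∑ j, (edgesBetween E (X j) (A.biUnion P) : ℤ) :=
        Finset.sum_le_sum fun j _ => hE.1.2.sub_le_edgesBetween hρ (hX.1 j) _
    _ ≤ _ := by
        rw [Finset.filter_mem_eq_inter, Finset.univ_inter]
        exact_mod_cast h1

/-- The edges entering `S₀ᶜ` number at least the sum of the relevant `f₁`. A vertex outside the
family contributes at most `gRestrict`; a member contributes at most its total `g` less the edges it
must send into `S₀`. -/
theorem IsGoodAugmentation.lowerIneq (hρ : IsRankLike ρ) (hP : IsPartition P)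
    (hE : IsGoodAugmentation ρ E₀ p P f₁ f₂ g E) {n : ℕ} {X : Fin n → Finset T} {S₀ : Finset S}
    (hX : IsDisjointFamily X) (hS₀ : IsUnionOfParts P S₀) : LowerIneq ρ E₀ p P f₁ g X S₀ := by
  obtain ⟨A, rfl⟩ := hS₀
  unfold LowerIneq
  simp_rw [hP.subset_compl_biUnion_iff]
  set Z := A.biUnion P with hZ
  have h1 : ∑ α with α ∉ A, f₁ α ≤ edgesBetween E Finset.univ Zᶜ := by
    rw [edgesBetween_univ_left, hP.compl_biUnion, hP.sum_biUnion,
      show (Finset.univ.filter fun α => α ∉ A) = Aᶜ by ext; simp]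
    exact Finset.sum_le_sum fun α _ => (hE.2.1 α).1
  have h2 : edgesBetween E Finset.univ Zᶜ = edgesBetween E (Finset.univ \ Finset.univ.biUnion X) Zᶜ
      + ∑ j, edgesBetween E (X j) Zᶜ := by
    rw [← edgesBetween_biUnion E hX]
    exact (Finset.sum_sdiff (Finset.subset_univ _)).symm
  have h3 : edgesBetween E (Finset.univ \ Finset.univ.biUnion X) Zᶜ
      ≤ ∑ t ∈ Finset.univ \ Finset.univ.biUnion X, gRestrict E₀ g Zᶜ t := by
    refine Finset.sum_le_sum fun t _ => le_min ?_ ?_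
    · rw [← Finset.card_filter]
      refine Finset.card_le_card fun s hs => ?_
      rw [Finset.mem_filter] at hs
      refine Finset.mem_sdiff.2 ⟨hs.1, fun h => ?_⟩
      obtain ⟨u, hu, hsu⟩ := mem_nbr.1 h
      rw [Finset.mem_singleton] at hu
      exact Finset.disjoint_left.1 hE.1.1 hs.2 (hu ▸ hsu)
    · refine le_trans ?_ (hE.2.2 t)
      rw [degT_eq]
      exact Finset.sum_le_sum_of_subset (Finset.subset_univ _)
  have h4 : ∀ j, p (X j) + (edgesBetween E (X j) Zᶜ : ℤ)
      ≤ (ρ (Zᶜ ∪ nbr E₀ (X j)) : ℤ) + ∑ t ∈ X j, (g t : ℤ) := by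
    intro j
    have a1 := hE.1.2.sub_le_edgesBetween hρ (hX.1 j) Z
    have a2 : edgesBetween E (X j) Z + edgesBetween E (X j) Zᶜ ≤ ∑ t ∈ X j, g t := by
      rw [edgesBetween_add_compl]
      exact Finset.sum_le_sum fun t _ => hE.2.2 t
    zify at a2
    linarith
  have h5 := Finset.sum_le_sum fun j (_ : j ∈ Finset.univ) => h4 j
  rw [Finset.sum_add_distrib] at h5
  zify at h1 h2 h3
  linarith

end Bipartite

/-! ### The demand function that encodes both covering and simplicity. -/

section Demand

variable {S T : Type*} [Fintype S] [DecidableEq S] [Fintype T] [DecidableEq T]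

/-- The vertices of `S` that are not in `Y`. -/
def outside (Y : Finset (Option S)) : Finset S := Finset.univ.filter fun s => some s ∉ Y

@[simp] theorem mem_outside {Y : Finset (Option S)} {s : S} : s ∈ outside Y ↔ some s ∉ Y := by
  simp [outside]

theorem outside_anti {Y Y' : Finset (Option S)} (h : Y ⊆ Y') : outside Y' ⊆ outside Y :=
  fun _ hs => mem_outside.2 fun hs' => mem_outside.1 hs (h hs')

theorem outside_inter (Y Y' : Finset (Option S)) :
    outside (Y ∩ Y') = outside Y ∪ outside Y' := by
  ext s
  simp only [mem_outside, Finset.mem_inter, Finset.mem_union]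
  tauto

theorem outside_union (Y Y' : Finset (Option S)) :
    outside (Y ∪ Y') = outside Y ∩ outside Y' := by
  ext s
  simp only [mem_outside, Finset.mem_inter, Finset.mem_union]
  tauto

/-- The number of new edges between `X` and `Y` that is needed to cover `X`. -/
def coverDemand (ρ : Finset S → ℕ) (E₀ : Finset (S × T)) (p : Finset T → ℤ) (X : Finset T)
    (Y : Finset (Option S)) : ℤ :=
  p X - ρ (outside Y ∪ nbr E₀ X)

/-- The number of edges between `t` and `Y ∋ none` that is needed if `t` has degree `g t` and there
is at most one edge, not parallel to an edge of `E₀`, between `t` and any `s ∈ S`. -/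
def simpleDemand (E₀ : Finset (S × T)) (g : T → ℕ) (t : T) (Y : Finset (Option S)) : ℤ :=
  g t - (outside Y \ nbr E₀ {t}).card

/-- The demand function whose covers are the good augmentations, up to the degrees in `S`; the edges
at `none` stand for unused degree in `T`. -/
def demand (ρ : Finset S → ℕ) (E₀ : Finset (S × T)) (p : Finset T → ℤ) (g : T → ℕ) (X : Finset T)
    (Y : Finset (Option S)) : ℤ :=
  if none ∈ Y ∧ X.card = 1 then
    max (coverDemand ρ E₀ p X Y) (∑ t ∈ X, simpleDemand E₀ g t Y)
  else coverDemand ρ E₀ p X Y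

variable {ρ : Finset S → ℕ} {E₀ : Finset (S × T)} {p : Finset T → ℤ} {g : T → ℕ}

theorem coverDemand_le (X : Finset T) (Y : Finset (Option S)) :
    coverDemand ρ E₀ p X Y ≤ demand ρ E₀ p g X Y := by
  unfold demand
  split_ifs
  · exact le_max_left _ _
  · exact le_rfl

theorem simpleDemand_le (t : T) {Y : Finset (Option S)} (hY : none ∈ Y) :
    simpleDemand E₀ g t Y ≤ demand ρ E₀ p g {t} Y := by
  rw [demand, if_pos ⟨hY, Finset.card_singleton t⟩, Finset.sum_singleton]
  exact le_max_right _ _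

theorem demand_cases (ρ : Finset S → ℕ) (E₀ : Finset (S × T)) (p : Finset T → ℤ) (g : T → ℕ)
    (X : Finset T) (Y : Finset (Option S)) :
    demand ρ E₀ p g X Y = coverDemand ρ E₀ p X Y ∨
      ∃ t, X = {t} ∧ none ∈ Y ∧ demand ρ E₀ p g X Y = simpleDemand E₀ g t Y := by
  unfold demand
  split_ifs with h
  · obtain ⟨t, rfl⟩ := Finset.card_eq_one.1 h.2
    rw [Finset.sum_singleton]
    exact (max_choice _ _).imp id fun h' => ⟨t, rfl, h.1, h'⟩
  · exact Or.inl rfl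

/-- Submodularity of `ρ` handles the subtracted term. Positive demand gives `p X > 0` and `p X' >
0`, as needed for supermodularity of `p`; nested pairs are trivial. -/
theorem coverDemand_add_le (hρ : IsRankLike ρ) (hp : PosIntersectingSupermodular p)
    {X X' : Finset T} {Y Y' : Finset (Option S)} (hX : (X ∩ X').Nonempty)
    (hpos : 0 < coverDemand ρ E₀ p X Y) (hpos' : 0 < coverDemand ρ E₀ p X' Y') :
    coverDemand ρ E₀ p X Y + coverDemand ρ E₀ p X' Y' ≤
      coverDemand ρ E₀ p (X ∪ X') (Y ∩ Y') + coverDemand ρ E₀ p (X ∩ X') (Y ∪ Y') := by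
  unfold coverDemand at *
  have h1 : p X + p X' ≤ p (X ∪ X') + p (X ∩ X') := by
    by_cases h : (X \ X').Nonempty
    · by_cases h' : (X' \ X).Nonempty
      · exact hp X X' ⟨hX, h, h'⟩ (by omega) (by omega)
      · rw [Finset.not_nonempty_iff_eq_empty, Finset.sdiff_eq_empty_iff_subset] at h'
        rw [Finset.union_eq_left.2 h', Finset.inter_eq_right.2 h']
    · rw [Finset.not_nonempty_iff_eq_empty, Finset.sdiff_eq_empty_iff_subset] at h
      rw [Finset.union_eq_right.2 h, Finset.inter_eq_left.2 h, add_comm]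
  have h2 := hρ.submod (outside Y ∪ nbr E₀ X) (outside Y' ∪ nbr E₀ X')
  have h3 : outside (Y ∩ Y') ∪ nbr E₀ (X ∪ X') =
      outside Y ∪ nbr E₀ X ∪ (outside Y' ∪ nbr E₀ X') := by
    rw [outside_inter, nbr_union_right]
    ext s
    simp only [Finset.mem_union]
    tauto
  have h4 := hρ.mono (outside (Y ∪ Y') ∪ nbr E₀ (X ∩ X'))
      ((outside Y ∪ nbr E₀ X) ∩ (outside Y' ∪ nbr E₀ X')) (by
    rw [outside_union]
    refine Finset.union_subset (Finset.inter_subset_inter Finset.subset_union_left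
      Finset.subset_union_left) (Finset.subset_inter ?_ ?_)
    · exact (nbr_mono E₀ Finset.inter_subset_left).trans Finset.subset_union_right
    · exact (nbr_mono E₀ Finset.inter_subset_right).trans Finset.subset_union_right)
  rw [h3]
  zify at h2 h4
  linarith

/-- Going from `Y'` to `Y ∩ Y'` raises the rank by at most the number of new vertices. These are
counted in `outside Y \ nbr E₀ {t}`, disjointly from `outside (Y ∪ Y') \ nbr E₀ {t}`. -/
theorem simpleDemand_add_coverDemand_le (hρ : IsRankLike ρ) {t : T} {X : Finset T}
    {Y Y' : Finset (Option S)} (ht : t ∈ X) :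
    simpleDemand E₀ g t Y + coverDemand ρ E₀ p X Y' ≤
      coverDemand ρ E₀ p X (Y ∩ Y') + simpleDemand E₀ g t (Y ∪ Y') := by
  unfold coverDemand simpleDemand
  have h1 := hρ.union_le (outside Y' ∪ nbr E₀ X) (outside (Y ∩ Y') ∪ nbr E₀ X)
  have h2 : outside Y' ∪ nbr E₀ X ∪ (outside (Y ∩ Y') ∪ nbr E₀ X) =
      outside (Y ∩ Y') ∪ nbr E₀ X := by
    rw [outside_inter]
    ext s
    simp only [Finset.mem_union]
    tauto
  have h3 : ((outside (Y ∩ Y') ∪ nbr E₀ X) \ (outside Y' ∪ nbr E₀ X)).card +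
      (outside (Y ∪ Y') \ nbr E₀ {t}).card ≤ (outside Y \ nbr E₀ {t}).card := by
    have hsub := nbr_mono E₀ (Finset.singleton_subset_iff.2 ht)
    rw [← Finset.card_union_of_disjoint]
    · refine Finset.card_le_card fun s hs => ?_
      have := @hsub s
      simp only [Finset.mem_union, Finset.mem_sdiff, mem_outside, Finset.mem_inter] at hs ⊢
      tauto
    · rw [Finset.disjoint_left]
      intro s
      simp only [Finset.mem_union, Finset.mem_sdiff, mem_outside]
      tauto
  rw [h2] at h1
  zify at h1 h3
  linarith

theorem simpleDemand_add_simpleDemand_le (t : T) (Y Y' : Finset (Option S)) :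
    simpleDemand E₀ g t Y + simpleDemand E₀ g t Y' ≤
      simpleDemand E₀ g t (Y ∩ Y') + simpleDemand E₀ g t (Y ∪ Y') := by
  unfold simpleDemand
  have h := Finset.card_union_add_card_inter (outside Y \ nbr E₀ {t}) (outside Y' \ nbr E₀ {t})
  rw [← Finset.union_sdiff_distrib, ← outside_inter,
    show outside Y \ nbr E₀ {t} ∩ (outside Y' \ nbr E₀ {t}) = outside (Y ∪ Y') \ nbr E₀ {t} by
      ext s
      simp only [Finset.mem_inter, Finset.mem_sdiff, mem_outside, Finset.mem_union]
      tauto] at h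
  zify at h
  linarith

theorem isDemand_demand (hρ : IsRankLike ρ) (hp : PosIntersectingSupermodular p)
    (E₀ : Finset (S × T)) (g : T → ℕ) : IsDemand (demand ρ E₀ p g) := by
  constructor
  · intro X Y Y' h
    rcases demand_cases ρ E₀ p g X Y with e | ⟨t, rfl, hY, e⟩ <;> rw [e]
    · refine le_trans ?_ (coverDemand_le X Y')
      have := hρ.mono _ _ (Finset.union_subset_union_left (t := nbr E₀ X) (outside_anti h))
      unfold coverDemand
      zify at this
      linarith
    · refine le_trans ?_ (simpleDemand_le t (h hY))
      have := Finset.card_le_card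
        (Finset.sdiff_subset_sdiff (outside_anti h) (subset_refl (nbr E₀ {t})))
      unfold simpleDemand
      zify at this
      linarith
  · intro X X' Y Y' hX hpos hpos'
    rcases demand_cases ρ E₀ p g X Y with e | ⟨t, rfl, hY, e⟩ <;>
      rcases demand_cases ρ E₀ p g X' Y' with e' | ⟨t', rfl, hY', e'⟩ <;>
      rw [e] at hpos ⊢ <;> rw [e'] at hpos' ⊢
    · exact (coverDemand_add_le hρ hp hX hpos hpos').trans
        (add_le_add (coverDemand_le _ _) (coverDemand_le _ _))
    · have ht : t' ∈ X := by
        obtain ⟨u, hu⟩ := hX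
        rw [Finset.mem_inter, Finset.mem_singleton] at hu
        exact hu.2 ▸ hu.1
      have hs := Finset.singleton_subset_iff.2 ht
      rw [Finset.union_eq_left.2 hs, Finset.inter_eq_right.2 hs]
      have h1 := simpleDemand_add_coverDemand_le (E₀ := E₀) (p := p) (g := g) (Y := Y') (Y' := Y)
        hρ ht
      rw [Finset.inter_comm, Finset.union_comm] at h1
      have h2 := coverDemand_le (ρ := ρ) (E₀ := E₀) (p := p) (g := g) X (Y ∩ Y')
      have h3 := simpleDemand_le (ρ := ρ) (E₀ := E₀) (p := p) (g := g) t'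
        (Finset.mem_union_right Y hY')
      linarith
    · have ht : t ∈ X' := by
        obtain ⟨u, hu⟩ := hX
        rw [Finset.mem_inter, Finset.mem_singleton] at hu
        exact hu.1 ▸ hu.2
      have hs := Finset.singleton_subset_iff.2 ht
      rw [Finset.union_eq_right.2 hs, Finset.inter_eq_left.2 hs]
      exact (simpleDemand_add_coverDemand_le hρ ht).trans (add_le_add (coverDemand_le _ _)
        (simpleDemand_le t (Finset.mem_union_left _ hY)))
    · obtain rfl : t = t' := by
        obtain ⟨u, hu⟩ := hX
        simp only [Finset.mem_inter, Finset.mem_singleton] at hu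
        exact hu.1.symm.trans hu.2
      rw [Finset.union_self, Finset.inter_self]
      exact (simpleDemand_add_simpleDemand_le t Y Y').trans (add_le_add
        (simpleDemand_le t (Finset.mem_inter.2 ⟨hY, hY'⟩))
        (simpleDemand_le t (Finset.mem_union_left _ hY)))

end Demand

/-! ### Sufficiency of the two inequalities. -/

section Sufficiency

variable {S T : Type*} [Fintype S] [DecidableEq S] [Fintype T] [DecidableEq T]

theorem IsFam.exists_fin {F : Finset (Finset T)} (hF : IsFam F) :
    ∃ X : Fin F.card → Finset T, IsDisjointFamily X ∧ Finset.univ.biUnion X = cov F ∧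
      ∀ φ : Finset T → ℤ, ∑ j, φ (X j) = ∑ Z ∈ F, φ Z := by
  refine ⟨fun j => (F.equivFin.symm j : Finset T), ⟨fun j => hF.1 _ (F.equivFin.symm j).2,
    fun i j hij => hF.2 _ (F.equivFin.symm i).2 _ (F.equivFin.symm j).2 fun h => hij
      (F.equivFin.symm.injective (Subtype.ext h))⟩, ?_, fun φ => ?_⟩
  · ext t
    rw [mem_cov, Finset.mem_biUnion]
    constructor
    · rintro ⟨j, -, hj⟩
      exact ⟨_, (F.equivFin.symm j).2, hj⟩
    · rintro ⟨Z, hZ, ht⟩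
      exact ⟨F.equivFin ⟨Z, hZ⟩, Finset.mem_univ _, by simpa using ht⟩
  · rw [F.equivFin.symm.sum_comp (fun Z : F => φ Z), Finset.sum_coe_sort]

theorem IsFam.sum_cov {F : Finset (Finset T)} (hF : IsFam F) (φ : T → ℤ) :
    ∑ t ∈ cov F, φ t = ∑ X ∈ F, ∑ t ∈ X, φ t :=
  Finset.sum_biUnion fun X hX X' hX' h => hF.2 X hX X' hX' h

variable {l : ℕ} {P : Fin l → Finset S} {ρ : Finset S → ℕ} {E₀ : Finset (S × T)}
  {p : Finset T → ℤ} {f₁ f₂ : Fin l → ℕ} {g : T → ℕ}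

/-- Without the dummy this is the upper inequality. With it, the lower inequality is applied to the
members whose demand comes from covering; the others are singletons, each demanding at most `g t -
gRestrict E₀ g (outside Y) t`. -/
theorem tot_demand_le_border (hP : IsPartition P) {cl : S → Fin l}
    (hcl : ∀ s α, s ∈ P α ↔ cl s = α)
    (h : ∀ (n : ℕ) (X : Fin n → Finset T) (S₀ : Finset S), IsDisjointFamily X →
      IsUnionOfParts P S₀ → LowerIneq ρ E₀ p P f₁ g X S₀ ∧ UpperIneq ρ E₀ p P f₂ X S₀)
    (A : Finset (Option (Fin l))) {F : Finset (Finset T)} (hF : IsFam F) :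
    tot (demand ρ E₀ p g) F (pre (Option.map cl) A) ≤ border (∑ t, g t) f₁ f₂ A := by
  set A' : Finset (Fin l) := Finset.univ.filter fun α => some α ∈ A
  have hout : outside (pre (Option.map cl) A) = (A'.biUnion P)ᶜ := by
    ext s
    simp [A', hcl]
  by_cases hA : none ∈ A
  · -- split the family according to the kind of the demand
    set Y := pre (Option.map cl) A with hY
    set F₁ := F.filter fun X => demand ρ E₀ p g X Y = coverDemand ρ E₀ p X Y
    set F₂ := F.filter fun X => ¬ demand ρ E₀ p g X Y = coverDemand ρ E₀ p X Y
    have hF₁ : IsFam F₁ := hF.subset (Finset.filter_subset _ _)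
    have hF₂ : IsFam F₂ := hF.subset (Finset.filter_subset _ _)
    have hsplit : tot (demand ρ E₀ p g) F Y =
        ∑ X ∈ F₁, coverDemand ρ E₀ p X Y + ∑ X ∈ F₂, demand ρ E₀ p g X Y := by
      rw [tot, ← Finset.sum_filter_add_sum_filter_not F
        (fun X => demand ρ E₀ p g X Y = coverDemand ρ E₀ p X Y)]
      congr 1
      exact Finset.sum_congr rfl fun X hX => (Finset.mem_filter.1 hX).2
    obtain ⟨X, hX, hXc, hXs⟩ := hF₁.exists_fin
    have hlow := (h _ X (A'.biUnion P) hX ⟨A', rfl⟩).1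
    unfold LowerIneq at hlow
    simp_rw [hP.subset_compl_biUnion_iff, hXc] at hlow
    rw [hXs p, hXs fun Z => (ρ ((A'.biUnion P)ᶜ ∪ nbr E₀ Z) : ℤ) + ∑ t ∈ Z, (g t : ℤ),
      Finset.sum_add_distrib, ← hF₁.sum_cov, ← hout] at hlow
    have h1 : ∑ X ∈ F₂, demand ρ E₀ p g X Y ≤
        ∑ t ∈ Finset.univ \ cov F₁, ((g t : ℤ) - gRestrict E₀ g (outside Y) t) := by
      calc _ ≤ ∑ X ∈ F₂, ∑ t ∈ X, ((g t : ℤ) - gRestrict E₀ g (outside Y) t) := by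
            refine Finset.sum_le_sum fun X hX => ?_
            rcases demand_cases ρ E₀ p g X Y with e | ⟨t, rfl, -, e⟩
            · exact absurd e (Finset.mem_filter.1 hX).2
            · rw [e, Finset.sum_singleton, simpleDemand, gRestrict]
              have : min (outside Y \ nbr E₀ {t}).card (g t) ≤ (outside Y \ nbr E₀ {t}).card :=
                min_le_left _ _
              zify at this ⊢
              linarith
        _ = ∑ t ∈ cov F₂, ((g t : ℤ) - gRestrict E₀ g (outside Y) t) := (hF₂.sum_cov _).symm
        _ ≤ _ := by
            refine Finset.sum_le_sum_of_subset_of_nonneg (fun t ht => ?_) fun t _ _ => ?_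
            · refine Finset.mem_sdiff.2 ⟨Finset.mem_univ t, fun ht' => ?_⟩
              obtain ⟨Z, hZ, htZ⟩ := mem_cov.1 ht
              obtain ⟨Z', hZ', htZ'⟩ := mem_cov.1 ht'
              rw [Finset.mem_filter] at hZ hZ'
              refine Finset.disjoint_left.1 (hF.2 Z hZ.1 Z' hZ'.1 ?_) htZ htZ'
              rintro rfl
              exact hZ.2 hZ'.2
            · have : gRestrict E₀ g (outside Y) t ≤ g t := min_le_right _ _
              zify at this
              linarith
    have h2 : ∑ t, (g t : ℤ) = ∑ t ∈ Finset.univ \ cov F₁, (g t : ℤ) + ∑ t ∈ cov F₁, (g t : ℤ) :=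
      (Finset.sum_sdiff (Finset.subset_univ _)).symm
    have h3 : ∑ X ∈ F₁, coverDemand ρ E₀ p X Y =
        ∑ X ∈ F₁, p X - ∑ X ∈ F₁, (ρ (outside Y ∪ nbr E₀ X) : ℤ) := by
      rw [← Finset.sum_sub_distrib]
      rfl
    have h4 : (Finset.univ.filter fun α => α ∉ A') = Finset.univ.filter fun α => some α ∉ A := by
      ext α
      simp [A']
    rw [h4] at hlow
    rw [Finset.sum_sub_distrib] at h1
    rw [border, if_pos hA, hsplit]
    push_cast
    linarith
  · obtain ⟨X, hX, -, hXs⟩ := hF.exists_fin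
    have hup := (h _ X (A'.biUnion P) hX ⟨A', rfl⟩).2
    unfold UpperIneq at hup
    simp_rw [hP.subset_biUnion_iff] at hup
    rw [hXs fun Z => p Z - (ρ ((A'.biUnion P)ᶜ ∪ nbr E₀ Z) : ℤ)] at hup
    have h1 : tot (demand ρ E₀ p g) F (pre (Option.map cl) A)
        = ∑ Z ∈ F, (p Z - (ρ ((A'.biUnion P)ᶜ ∪ nbr E₀ Z) : ℤ)) := by
      refine Finset.sum_congr rfl fun Z _ => ?_
      rw [demand, if_neg (by simp [hA]), coverDemand, hout]
    rw [border, if_neg hA, h1]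
    simpa [A'] using hup

theorem exists_isGoodAugmentation (hρ : IsRankLike ρ) (hp : PosIntersectingSupermodular p)
    (hP : IsPartition P) (hf : ∀ α, f₁ α ≤ f₂ α)
    (h : ∀ (n : ℕ) (X : Fin n → Finset T) (S₀ : Finset S), IsDisjointFamily X →
      IsUnionOfParts P S₀ → LowerIneq ρ E₀ p P f₁ g X S₀ ∧ UpperIneq ρ E₀ p P f₂ X S₀) :
    ∃ E, IsGoodAugmentation ρ E₀ p P f₁ f₂ g E := by
  have hex : ∀ s, ∃ α, s ∈ P α := fun s => by
    obtain ⟨α, -, hα⟩ := Finset.mem_biUnion.1 (hP.2.2.symm ▸ Finset.mem_univ s)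
    exact ⟨α, hα⟩
  choose cl hcl' using hex
  have hcl : ∀ s α, s ∈ P α ↔ cl s = α := by
    refine fun s α => ⟨fun hs => ?_, fun e => e ▸ hcl' s⟩
    by_contra hne
    exact Finset.disjoint_left.1 (hP.2.1 _ _ hne) (hcl' s) hs
  have hq := isDemand_demand hρ hp E₀ g
  obtain ⟨n, hn⟩ := Nat.exists_eq_add_of_le (Finset.sum_le_sum fun α (_ : α ∈ Finset.univ) => hf α)
  obtain ⟨f, hff, hfit⟩ := exists_exact hq (Option.map cl) (∑ t, g t) n f₁ f₂ hn hf
    fun A F hF => tot_demand_le_border hP hcl h A hF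
  -- The empty family at `{none}` says that the dummy's prescribed degree is nonnegative.
  have hfG : ∑ α, f α ≤ ∑ t, g t := by
    have := hfit {none} ∅ isFam_empty
    simp only [tot, Finset.sum_empty, border, Finset.mem_singleton, if_true, reduceCtorEq,
      not_false_eq_true, Finset.filter_true] at this
    zify
    push_cast at this
    linarith
  set m : Option (Fin l) → ℕ := fun i => Option.elim i (∑ t, g t - ∑ α, f α) f
  have hm : Fits (demand ρ E₀ p g) (Option.map cl) m := fun A F hF =>
    (hfit A F hF).trans (border_self_eq_sum hfG A).le
  have hmsum : ∑ i, m i = ∑ t, g t := by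
    rw [Fintype.sum_option]
    exact Nat.sub_add_cancel hfG
  obtain ⟨x, hx, hxm⟩ := exists_cover _ _ m rfl hq hm (by
    have : ∑ i, (m i : ℤ) = ∑ t, (g t : ℤ) := by exact_mod_cast hmsum
    rw [this]
    refine Finset.sum_le_sum fun t _ => ?_
    refine le_trans ?_ (simpleDemand_le t (Finset.mem_univ none))
    simp [simpleDemand, outside])
  -- all degrees are attained
  have hxt : ∀ t, g t ≤ ∑ k, x t k := by
    intro t
    have h1 := hx {t} Finset.univ (Finset.singleton_nonempty t)
    have h2 := simpleDemand_le (ρ := ρ) (E₀ := E₀) (p := p) (g := g) t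
      (Finset.mem_univ (none : Option S))
    have h3 : simpleDemand E₀ g t Finset.univ = g t := by simp [simpleDemand, outside]
    rw [Finset.sum_singleton] at h1
    zify
    linarith
  have hswap : ∑ i, ∑ t, ∑ k with Option.map cl k = i, x t k = ∑ t, ∑ k, x t k := by
    rw [Finset.sum_comm]
    exact Finset.sum_congr rfl fun t _ => Finset.sum_fiberwise _ _ _
  have hle1 := Finset.sum_le_sum fun i (_ : i ∈ Finset.univ) => hxm i
  have hle2 := Finset.sum_le_sum fun t (_ : t ∈ Finset.univ) => hxt t
  -- Degrees are at least `g` in `T` and at most `m` on the classes, and both bounds have the same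
  -- total.
  have hxt' : ∀ t, g t = ∑ k, x t k := fun t =>
    (Finset.sum_eq_sum_iff_of_le fun t _ => hxt t).1 (by omega) t (Finset.mem_univ t)
  have hxm' : ∀ i, ∑ t, ∑ k with Option.map cl k = i, x t k = m i := fun i =>
    (Finset.sum_eq_sum_iff_of_le fun i _ => hxm i).1 (by omega) i (Finset.mem_univ i)
  -- The demand of `{t}` at everything except `s` leaves at most one edge for `s`, and none if `(s,
  -- t)` is an old edge.
  have hx1 : ∀ t s, x t (some s) ≤ if (s, t) ∈ E₀ then 0 else 1 := by
    intro t s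
    have h1 := hx {t} (Finset.univ.erase (some s)) (Finset.singleton_nonempty t)
    have h2 := simpleDemand_le (ρ := ρ) (E₀ := E₀) (p := p) (g := g) t
      (Y := Finset.univ.erase (some s)) (by simp)
    have h3 : outside (Finset.univ.erase (some s)) = {s} := by
      ext s'
      simp
    have h4 := Finset.add_sum_erase Finset.univ (fun k => x t k) (Finset.mem_univ (some s))
    rw [← hxt' t] at h4
    have h5 : ({s} \ nbr E₀ {t}).card ≤ if (s, t) ∈ E₀ then 0 else 1 := by
      split_ifs with hst
      · simp [mem_nbr, hst]
      · exact (Finset.card_le_card Finset.sdiff_subset).trans (by simp)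
    rw [Finset.sum_singleton] at h1
    rw [simpleDemand, h3] at h2
    refine le_trans ?_ h5
    zify at h4 ⊢
    linarith
  set E : Finset (S × T) := Finset.univ.filter fun e => x e.2 (some e.1) ≠ 0
  have hE : ∀ s t, (if (s, t) ∈ E then 1 else 0) = x t (some s) := by
    intro s t
    have h1 := hx1 t s
    have h2 : x t (some s) ≤ 1 := h1.trans (by split_ifs <;> simp)
    by_cases h0 : x t (some s) = 0
    · simp [E, h0]
    · simp only [E, Finset.mem_filter, Finset.mem_univ, true_and, ne_eq, h0, not_false_eq_true,
        if_true]
      omega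
  refine ⟨E, ⟨?_, fun X hX => ?_⟩, fun α => ?_, fun t => ?_⟩
  · rw [Finset.disjoint_left]
    rintro ⟨s, t⟩ he he0
    have h1 := hx1 t s
    rw [if_pos he0] at h1
    simp only [E, Finset.mem_filter] at he
    omega
  -- The test set consists of the non-neighbours of `X`, without the dummy. No edge joins it to `X`,
  -- so its demand is at most zero, which is the covering inequality.
  · have h1 := hx X (Finset.univ.filter fun k => ∃ s ∉ nbr E X, k = some s) hX
    have h2 := coverDemand_le (ρ := ρ) (E₀ := E₀) (p := p) (g := g) X
      (Finset.univ.filter fun k => ∃ s ∉ nbr E X, k = some s)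
    have h3 : outside (Finset.univ.filter fun k => ∃ s ∉ nbr E X, k = some s) = nbr E X := by
      ext s
      simp
    rw [coverDemand, h3, ← nbr_union_left] at h2
    have h4 : ∑ t ∈ X, ∑ k ∈ Finset.univ.filter (fun k => ∃ s ∉ nbr E X, k = some s),
        (x t k : ℤ) = 0 := by
      refine Finset.sum_eq_zero fun t ht => Finset.sum_eq_zero fun k hk => ?_
      obtain ⟨-, s, hs, rfl⟩ := Finset.mem_filter.1 hk
      by_contra h0
      refine hs (mem_nbr.2 ⟨t, ht, ?_⟩)
      simpa [E] using h0
    linarith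
  · have h1 : ∑ s ∈ P α, degS E s = f α := by
      have h2 := hxm' (some α)
      rw [Finset.sum_comm] at h2
      have h3 : (Finset.univ.filter fun k => Option.map cl k = some α)
          = (P α).map Function.Embedding.some := by
        ext k
        cases k with
        | none => simp
        | some s => simp [hcl]
      rw [h3, Finset.sum_map] at h2
      simp_rw [degS_eq, hE]
      exact h2
    rw [h1]
    exact hff α
  · rw [degT_eq, hxt' t, Fintype.sum_option]
    simp_rw [hE]
    exact Nat.le_add_left _ _

theorem exists_isGoodAugmentation_iff (hρ : IsRankLike ρ) (hp : PosIntersectingSupermodular p)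
    (hP : IsPartition P) (hf : ∀ α, f₁ α ≤ f₂ α) :
    (∃ E, IsGoodAugmentation ρ E₀ p P f₁ f₂ g E) ↔
      ∀ (n : ℕ) (X : Fin n → Finset T) (S₀ : Finset S), IsDisjointFamily X →
        IsUnionOfParts P S₀ → LowerIneq ρ E₀ p P f₁ g X S₀ ∧ UpperIneq ρ E₀ p P f₂ X S₀ :=
  ⟨fun ⟨_, hE⟩ _ _ _ hX hS₀ => ⟨hE.lowerIneq hρ hP hX hS₀, hE.upperIneq hρ hP hX hS₀⟩,
    exists_isGoodAugmentation hρ hp hP hf⟩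

end Sufficiency

end BipCover

theorem theorem5p3 {S T : Type*} [Fintype S] [DecidableEq S] [Fintype T] [DecidableEq T]
    (E₀ : Finset (S × T)) (p : Finset T → ℤ)
    (hp : BipCover.PosIntersectingSupermodular p)
    (hpS : ∀ X : Finset T, p X ≤ (Fintype.card S : ℤ))
    {l : ℕ} (P : Fin l → Finset S) (hP : BipCover.IsPartition P)
    (f₁ f₂ : Fin l → ℕ) (hf : ∀ α, f₁ α ≤ f₂ α) (g : T → ℕ) :
    -- the characterization
    ((∃ E : Finset (S × T), BipCover.IsGoodAugmentation Finset.card E₀ p P f₁ f₂ g E) ↔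
      ∀ (n : ℕ) (X : Fin n → Finset T) (S₀ : Finset S),
        BipCover.IsDisjointFamily X → BipCover.IsUnionOfParts P S₀ →
          BipCover.LowerIneq Finset.card E₀ p P f₁ g X S₀ ∧
          BipCover.UpperIneq Finset.card E₀ p P f₂ X S₀) ∧
    -- the particular case `n = 0` of the first inequality
    (∀ (X : Fin 0 → Finset T) (S₀ : Finset S),
      BipCover.LowerIneq Finset.card E₀ p P f₁ g X S₀ →
        ∑ α with P α ⊆ S₀ᶜ, f₁ α ≤ ∑ t, BipCover.gRestrict E₀ g S₀ᶜ t) ∧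
    -- the matroidal version
    (∀ M : Matroid S, M.E = Set.univ →
      ((∃ E : Finset (S × T),
          BipCover.IsGoodAugmentation (BipCover.rank M) E₀ p P f₁ f₂ g E) ↔
        ∀ (n : ℕ) (X : Fin n → Finset T) (S₀ : Finset S),
          BipCover.IsDisjointFamily X → BipCover.IsUnionOfParts P S₀ →
            BipCover.LowerIneq (BipCover.rank M) E₀ p P f₁ g X S₀ ∧
            BipCover.UpperIneq (BipCover.rank M) E₀ p P f₂ X S₀)) := by
  refine ⟨BipCover.exists_isGoodAugmentation_iff BipCover.isRankLike_card hp hP hf,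
    fun X S₀ h => ?_,
    fun M _ => BipCover.exists_isGoodAugmentation_iff (BipCover.isRankLike_rank M) hp hP hf⟩
  simp only [BipCover.LowerIneq, Finset.univ_eq_empty, Finset.sum_empty, Finset.biUnion_empty,
    Finset.sdiff_empty] at h
  zify
  linarith
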